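/- Let $x,\zeta:[0,+\infty)\to\mathbb R$ be càdlàg (right-continuous at every $t\ge 0$, with finite left limits at every $t>0$), let $\varphi:(0,+\infty)\to[0,+\infty)$ satisfy $\lim_{c\downarrow 0}\varphi(c)=0$, and write $x_{s-}$ for the left limit of $x$ at $s>0$. For $c>0$ and $t\ge 0$ put $\mathrm{TV}^c(x,[0,t])=\sup\sum_i(|x_{u_{i+1}}-x_{u_i}|-c)_+$, $\mathrm{UTV}^c(x,[0,t])=\sup\sum_i(x_{u_{i+1}}-x_{u_i}-c)_+$ and $\mathrm{DTV}^c(x,[0,t])=\sup\sum_i(x_{u_i}-x_{u_{i+1}}-c)_+$, where the suprema are over all finite partitions $0=u_0\le u_1\le\dots\le u_n=t$ of $[0,t]$ (for $t=0$ these quantities are $0$). For $y\in\mathbb R$ and $c>0$ let $\sigma_0=0$ and, for $n\ge 0$, $\rho_n=\inf\{u\in[\sigma_n,t]:x_u\ge y+c/2\}$ and $\sigma_{n+1}=\inf\{u\in[\rho_n,t]:x_u<y-c/2\}$, with $\inf\emptyset=+\infty$ and $[+\infty,t]=\emptyset$. The numbers of downcrossings, upcrossings and crossings of $[y-c/2,y+c/2]$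 by $x$ on $[0,t]$ are $\mathrm d^{y,c}(x,[0,t])=\max\{n:\sigma_n\le t\}$, $\mathrm u^{y,c}(x,[0,t])=\mathrm d^{-y,c}(-x,[0,t])$ and $\mathrm n^{y,c}(x,[0,t])=\mathrm u^{y,c}(x,[0,t])+\mathrm d^{y,c}(x,[0,t])$. Then the following three conditions are equivalent: 1. for every $t\ge 0$, $\varphi(c)\,\mathrm{TV}^c(x,[0,t])\to\zeta_t$ as $c\downarrow 0$; 2. for every $t\ge 0$, $2\varphi(c)\,\mathrm{UTV}^c(x,[0,t])\to\zeta_t$ as $c\downarrow 0$; 3. for every $t\ge 0$, $2\varphi(c)\,\mathrm{DTV}^c(x,[0,t])\to\zeta_t$ as $c\downarrow 0$. If any of them holds, then $\zeta$ is non-negative and non-decreasing, and for every continuous $g:\mathbb R\to\mathbb R$ and every $t\ge 0$ $$\varphi(c)\int_{\mathbb R}\mathrm n^{y,c}(x,[0,t])\,g(y)\,\mathrm dy\;\longrightarrow\;\int_{(0,t]}g(x_{s-})\,\mathrm d\zeta_s\qquad\text{as }c\downarrow 0,$$ where the integral on the right is a Lebesgue–Stieltjes integral, and the integrals on both sides (for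 every $c>0$ on the left) converge absolutely. The same holds with $\mathrm n^{y,c}(x,[0,t])$ replaced by $2\mathrm u^{y,c}(x,[0,t])$ or by $2\mathrm d^{y,c}(x,[0,t])$. If moreover $\zeta$ is continuous, then each of these three convergences is uniform in $t$ on compact subsets of $[0,+\infty)$. -/

import Mathlib

open Set Filter Topology MeasureTheory
open scoped NNReal ENNReal

noncomputable section

/-- A càdlàg path on `[0, ∞)`: right-continuous at every `t ≥ 0`, with a (finite) left limit at
every `t > 0`. -/
def IsCadlag (x : ℝ≥0 → ℝ) : Prop :=
  (∀ t : ℝ≥0, ContinuousWithinAt x (Ici t) t) ∧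
    ∀ t : ℝ≥0, 0 < t → ∃ l : ℝ, Tendsto x (𝓝[<] t) (𝓝 l)

/-- `s = u 0 ≤ u 1 ≤ ⋯ ≤ u n = t`: the finite partition of `[s, t]` into the intervals
`[u i, u (i + 1)]`, `i < n`.  Repeated points are allowed; they contribute `(0 - c)₊ = 0` to the
sums below when `c ≥ 0`. -/
def IsPartition (s t : ℝ≥0) (n : ℕ) (u : ℕ → ℝ≥0) : Prop :=
  Monotone u ∧ u 0 = s ∧ u n = t

/-- The truncated variation `TV^c(x, [s, t])`, an extended non-negative number.
Note that `ENNReal.ofReal a` is the positive part `a₊`. -/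
def truncVar (c : ℝ) (x : ℝ≥0 → ℝ) (s t : ℝ≥0) : ℝ≥0∞ :=
  ⨆ (n : ℕ) (u : ℕ → ℝ≥0) (_ : IsPartition s t n u),
    ∑ i ∈ Finset.range n, ENNReal.ofReal (|x (u (i + 1)) - x (u i)| - c)

/-- The upward truncated variation `UTV^c(x, [s, t])`. -/
def upTruncVar (c : ℝ) (x : ℝ≥0 → ℝ) (s t : ℝ≥0) : ℝ≥0∞ :=
  ⨆ (n : ℕ) (u : ℕ → ℝ≥0) (_ : IsPartition s t n u),
    ∑ i ∈ Finset.range n, ENNReal.ofReal (x (u (i + 1)) - x (u i) - c)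

/-- The downward truncated variation `DTV^c(x, [s, t])`. -/
def downTruncVar (c : ℝ) (x : ℝ≥0 → ℝ) (s t : ℝ≥0) : ℝ≥0∞ :=
  ⨆ (n : ℕ) (u : ℕ → ℝ≥0) (_ : IsPartition s t n u),
    ∑ i ∈ Finset.range n, ENNReal.ofReal (x (u i) - x (u (i + 1)) - c)

/-- `inf {u ∈ [a, t] : x u ∈ A}`, with `inf ∅ = ∞` and `[∞, t] = ∅`. -/
def firstTime (x : ℝ≥0 → ℝ) (A : Set ℝ) (a : ℝ≥0∞) (t : ℝ≥0) : ℝ≥0∞ :=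
  ⨅ (u : ℝ≥0) (_ : a ≤ (u : ℝ≥0∞) ∧ u ≤ t ∧ x u ∈ A), (u : ℝ≥0∞)

/-- The times `σ n`: `σ 0 = s`, and `σ (n + 1) = inf {u ∈ [ρ n, t] : x u < y - c / 2}` where
`ρ n = inf {u ∈ [σ n, t] : x u ≥ y + c / 2}`. -/
def downTime (y c : ℝ) (x : ℝ≥0 → ℝ) (s t : ℝ≥0) : ℕ → ℝ≥0∞
  | 0 => (s : ℝ≥0∞)
  | n + 1 => firstTime x (Iio (y - c / 2))
      (firstTime x (Ici (y + c / 2)) (downTime y c x s t n) t) t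

/-- The number `d^{y,c}(x, [s, t]) = max {n : σ n ≤ t}` of downcrossings of
`[y - c / 2, y + c / 2]`.  The set is finite for a càdlàg path and `c > 0`. -/
def downCross (y c : ℝ) (x : ℝ≥0 → ℝ) (s t : ℝ≥0) : ℕ :=
  sSup {n : ℕ | downTime y c x s t n ≤ (t : ℝ≥0∞)}

/-- The number `u^{y,c}(x, [s, t])` of upcrossings of `[y - c / 2, y + c / 2]`. -/
def upCross (y c : ℝ) (x : ℝ≥0 → ℝ) (s t : ℝ≥0) : ℕ :=
  downCross (-y) c (fun u => -x u) s t

/-- The number `n^{y,c}(x, [s, t])` of crossings of `[y - c / 2, y + c / 2]`. -/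
def crossNum (y c : ℝ) (x : ℝ≥0 → ℝ) (s t : ℝ≥0) : ℕ :=
  upCross y c x s t + downCross y c x s t

/-- The Lebesgue–Stieltjes measure `dζ` on `[0, ∞)` of a non-decreasing càdlàg function `ζ`; it
gives mass `ζ b - ζ a` to `(a, b]`. -/
def stieltjesMeasure (ζ : ℝ≥0 → ℝ) (hm : Monotone ζ) (hc : IsCadlag ζ) : Measure ℝ≥0 :=
  StieltjesFunction.measure
    { toFun := ζ
      mono' := hm
      right_continuous' := hc.1 }

end

/-! Everything rests on a Banach indicatrix formula with threshold, `IsCadlag.lintegral_downCross`: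
integrating the number of downcrossings over all levels gives exactly the downward truncated
variation. One inequality comes from partitions: a drop from `x a` to `x b` is a downcrossing for a
set of levels of length `(x a - x b - c)₊`. For the other, a relay at level `y` with thresholds `y ±
c / 2` is on exactly when the play operator of width `c` exceeds `y`. Hence downcrossings on a grid
are counted by the falls of the play past `y`; the integral over `y` of these counts is the total
decrease of the play, which DTV dominates (`sum_play_le`). Fatou's lemma passes from grids to the
path.

The three normalisations are equivalent because TV, 2 UTV and 2 DTV differ by a bound independent of
`c` (`IsCadlag.abs_truncVar_sub_le`), which `φ c → 0` kills.

The weighted limit is a localisation argument. Cut `[0, t]` into finitely many blocks `[uᵢ, uᵢ₊₁)`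
on which `x` stays within `ε` of `x uᵢ`. Levels farther than `ε` from `x uᵢ` gain at most one
downcrossing up to time `uᵢ₊₁`, however small `c` is, even if `x` jumps at `uᵢ₊₁`. So up to a
bounded error all new crossings occur at levels where `g ≈ g (x uᵢ)`, and the indicatrix formula
turns the integral into a Riemann–Stieltjes sum against DTV. After multiplication by `2 φ c` it
tends to the sum against `ζ`. The left limit appears because it, unlike `x` itself, remains within
`ε` of `x uᵢ` on all of `(uᵢ, uᵢ₊₁]`.

For continuous `ζ`, Pólya's theorem upgrades this to uniform convergence, after splitting `g` into
positive and negative parts. Upcrossings follow by replacing `x` with `-x`. -/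

/-! ### Downcrossings as alternating visits to two sets -/

/-- There are times `a₁ ≤ b₁ ≤ a₂ ≤ ⋯ ≤ bₙ ≤ t` with `v (a i) ∈ A` and `v (b i) ∈ B`. -/
def Alternates {ι : Type*} [Preorder ι] (v : ι → ℝ) (A B : Set ℝ) : ℕ → ι → Prop
  | 0, _ => True
  | n + 1, t => ∃ a b, Alternates v A B n a ∧ a ≤ b ∧ b ≤ t ∧ v a ∈ A ∧ v b ∈ B

namespace Alternates

variable {ι : Type*} [Preorder ι] {v : ι → ℝ} {A B : Set ℝ}

lemma mono_time {n : ℕ} {s t : ι} (h : Alternates v A B n s) (hst : s ≤ t) :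
    Alternates v A B n t := by
  cases n with
  | zero => trivial
  | succ n =>
    obtain ⟨a, b, h1, h2, h3, h4⟩ := h
    exact ⟨a, b, h1, h2, h3.trans hst, h4⟩

lemma of_succ {n : ℕ} {t : ι} (h : Alternates v A B (n + 1) t) : Alternates v A B n t := by
  obtain ⟨a, b, h1, h2, h3, -⟩ := h
  exact h1.mono_time (h2.trans h3)

lemma anti {m n : ℕ} (hmn : m ≤ n) {t : ι} (h : Alternates v A B n t) : Alternates v A B m t := by
  induction hmn with
  | refl => exact h
  | step _ ih => exact ih h.of_succ

end Alternates

/-- A new alternation needs two distinct times, one in each set. If the path avoids `A` on `[s, t)`,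
the last visit to `A` is before `s`; if it avoids `B`, the visit to `B` before that is no later than
`s`. Nothing is assumed about `x t`, so a jump at `t` is allowed. -/
lemma Alternates.pred_of_Ico {x : ℝ≥0 → ℝ} {A B : Set ℝ} (hAB : Disjoint A B) {s t : ℝ≥0}
    (h : (∀ r, s ≤ r → r < t → x r ∉ A) ∨ (∀ r, s ≤ r → r < t → x r ∉ B)) {n : ℕ}
    (hn : Alternates x A B (n + 1) t) : Alternates x A B n s := by
  obtain ⟨a, b, h1, h2, h3, h4, h5⟩ := hn
  rcases h with h | h
  · have ha : a < s := by
      by_contra! hs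
      rcases (h2.trans h3).lt_or_eq with h6 | h6
      · exact h a hs h6 h4
      · have : a = b := le_antisymm h2 (h3.trans h6.ge)
        subst this
        exact hAB.le_bot ⟨h4, h5⟩
    exact h1.mono_time ha.le
  · cases n with
    | zero => trivial
    | succ n =>
      obtain ⟨a', b', g1, g2, g3, g4, g5⟩ := h1
      refine ⟨a', b', g1, g2, ?_, g4, g5⟩
      by_contra! hs
      rcases (g3.trans (h2.trans h3)).lt_or_eq with h6 | h6
      · exact h b' hs.le h6 g5
      · have : a = b := le_antisymm h2 (h3.trans (h6.ge.trans g3))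
        subst this
        exact hAB.le_bot ⟨h4, h5⟩

/-- The infimum need not be attained. But if `x` avoids `A` on some `[b, u)`, an infimum below `u`
must be approached by visits before `b`. -/
lemma exists_of_firstTime_le {x : ℝ≥0 → ℝ} {A : Set ℝ} {r : ℝ≥0∞} {t b : ℝ≥0}
    (h : firstTime x A r t ≤ b) (hb : ∀ᶠ s in 𝓝[≥] b, x s ∉ A) :
    ∃ a ≤ b, r ≤ a ∧ a ≤ t ∧ x a ∈ A := by
  obtain ⟨u, hu, hsub⟩ := (mem_nhdsGE_iff_exists_Ico_subset (a := b)).1 hb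
  have : firstTime x A r t < u := h.trans_lt (by exact_mod_cast hu)
  simp only [firstTime, iInf_lt_iff] at this
  obtain ⟨a, ⟨h1, h2, h3⟩, h4⟩ := this
  refine ⟨a, ?_, h1, h2, h3⟩
  by_contra! hab
  exact hsub ⟨hab.le, by exact_mod_cast h4⟩ h3

lemma downTime_le_of_alternates {x : ℝ≥0 → ℝ} {y c : ℝ} {t : ℝ≥0} {n : ℕ} :
    ∀ {r : ℝ≥0}, r ≤ t → Alternates x (Ici (y + c / 2)) (Iio (y - c / 2)) n r →
      downTime y c x 0 t n ≤ r := by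
  induction n with
  | zero => intro r _ _; simp [downTime]
  | succ n ih =>
    rintro r hr ⟨a, b, h1, h2, h3, h4, h5⟩
    have hbt := h3.trans hr
    have hat := h2.trans hbt
    have ha : firstTime x (Ici (y + c / 2)) (downTime y c x 0 t n) t ≤ a :=
      iInf₂_le a ⟨ih hat h1, hat, h4⟩
    have hb : downTime y c x 0 t (n + 1) ≤ b :=
      iInf₂_le b ⟨ha.trans (by exact_mod_cast h2), hbt, h5⟩
    exact hb.trans (by exact_mod_cast h3)

lemma alternates_of_downTime_le {x : ℝ≥0 → ℝ} (hx : ∀ t, ContinuousWithinAt x (Ici t) t)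
    {y c : ℝ} (hc : 0 < c) {t : ℝ≥0} {n : ℕ} (h : downTime y c x 0 t n ≤ t) :
    Alternates x (Ici (y + c / 2)) (Iio (y - c / 2)) n t := by
  -- The stopping times are infima, so the induction runs over actual times at which the path is in
  -- the required set. There right-continuity keeps it out of the other set for a while, and the
  -- earlier visit can be extracted.
  have key : ∀ n, (∀ a ≤ t, downTime y c x 0 t n ≤ a → x a ∈ Ici (y + c / 2) →
      Alternates x (Ici (y + c / 2)) (Iio (y - c / 2)) n a) →
      ∀ b ≤ t, firstTime x (Ici (y + c / 2)) (downTime y c x 0 t n) t ≤ b →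
      x b ∈ Iio (y - c / 2) → Alternates x (Ici (y + c / 2)) (Iio (y - c / 2)) (n + 1) b := by
    intro n hn b hbt hb hxb
    have hev : ∀ᶠ s in 𝓝[≥] b, x s ∉ Ici (y + c / 2) := by
      filter_upwards [(hx b).eventually_lt_const (u := y + c / 2) (by
        simp only [mem_Iio] at hxb; linarith)] with s hs
      simpa using hs
    obtain ⟨a, hab, h1, h2, h3⟩ := exists_of_firstTime_le hb hev
    exact ⟨a, b, hn a h2 h1 h3, hab, le_rfl, h3, hxb⟩
  have main : ∀ n, ∀ a ≤ t, downTime y c x 0 t n ≤ a → x a ∈ Ici (y + c / 2) →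
      Alternates x (Ici (y + c / 2)) (Iio (y - c / 2)) n a := by
    intro n
    induction n with
    | zero => intros; trivial
    | succ n ih =>
      intro a hat ha hxa
      have hev : ∀ᶠ s in 𝓝[≥] a, x s ∉ Iio (y - c / 2) := by
        filter_upwards [(hx a).eventually_const_lt (u := y - c / 2) (by
          simp only [mem_Ici] at hxa; linarith)] with s hs
        simpa using hs.le
      obtain ⟨b, hba, h1, h2, h3⟩ := exists_of_firstTime_le ha hev
      exact (key n ih b h2 h1 h3).mono_time hba
  cases n with
  | zero => trivial
  | succ n =>
    have : downTime y c x 0 t (n + 1) < ⊤ := h.trans_lt ENNReal.coe_lt_top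
    simp only [downTime, firstTime, iInf_lt_iff] at this
    obtain ⟨b, ⟨h1, h2, h3⟩, -⟩ := this
    exact (key n (main n) b h2 h1 h3).mono_time h2

lemma downTime_le_iff {x : ℝ≥0 → ℝ} (hx : ∀ t, ContinuousWithinAt x (Ici t) t)
    {y c : ℝ} (hc : 0 < c) {t : ℝ≥0} {n : ℕ} : downTime y c x 0 t n ≤ t ↔
    Alternates x (Ici (y + c / 2)) (Iio (y - c / 2)) n t :=
  ⟨alternates_of_downTime_le hx hc, downTime_le_of_alternates le_rfl⟩

/-! ### Regularity of càdlàg paths -/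

namespace IsCadlag

variable {x : ℝ≥0 → ℝ}

lemma neg (hx : IsCadlag x) : IsCadlag fun u => -x u :=
  ⟨fun t => (hx.1 t).neg, fun t ht => (hx.2 t ht).imp' Neg.neg fun _ h => h.neg⟩

lemma tendsto_leftLim (hx : IsCadlag x) {t : ℝ≥0} (ht : 0 < t) :
    Tendsto x (𝓝[<] t) (𝓝 (Function.leftLim x t)) :=
  tendsto_leftLim_of_tendsto (hx.2 t ht)

/-- The interval `[0, t]` splits into finitely many `[t i, t (i + 1))` on which a càdlàg path
oscillates little. -/
lemma exists_partition (hx : IsCadlag x) {ε : ℝ} (hε : 0 < ε) (t : ℝ≥0) :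
    ∃ m u, IsPartition 0 t m u ∧
      ∀ i < m, ∀ s, u i ≤ s → s < u (i + 1) → |x s - x (u i)| ≤ ε := by
  set P : ℝ≥0 → Prop := fun t => ∃ m u, IsPartition 0 t m u ∧
      ∀ i < m, ∀ s, u i ≤ s → s < u (i + 1) → |x s - x (u i)| ≤ ε with hP
  have extend : ∀ a b, P a → a ≤ b → (∀ s, a ≤ s → s < b → |x s - x a| ≤ ε) → P b := by
    rintro a b ⟨m, u, ⟨h1, h2, h3⟩, h4⟩ hab h
    refine ⟨m + 1, fun i => if i ≤ m then u i else b, ⟨?_, by simpa using h2, by simp⟩, ?_⟩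
    · refine monotone_nat_of_le_succ fun i => ?_
      by_cases hi : i + 1 ≤ m
      · simp [hi, (Nat.le_succ i).trans hi, h1 (Nat.le_succ i)]
      · by_cases hi' : i ≤ m
        · simp only [hi', hi, if_true, if_false]
          exact (h1 hi').trans (h3.le.trans hab)
        · simp [hi, hi']
    · intro i hi s
      have him : i ≤ m := Nat.lt_succ_iff.1 hi
      by_cases hi' : i + 1 ≤ m
      · simp only [him, hi', if_true]
        exact h4 i hi' s
      · have : i = m := by omega
        subst this
        simp only [le_refl, if_true, hi', if_false, h3]
        exact h s
  have h0 : P 0 := ⟨0, fun _ => 0, ⟨monotone_const, rfl, rfl⟩, by simp⟩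
  by_contra hcon
  set S : Set ℝ≥0 := {s | s ≤ t ∧ P s} with hS
  have hne : S.Nonempty := ⟨0, zero_le, h0⟩
  have hbdd : BddAbove S := ⟨t, fun s hs => hs.1⟩
  have hst : sSup S ≤ t := csSup_le hne fun s hs => hs.1
  -- The left limit at the supremum gives a final block of small oscillation, so the supremum is
  -- attained; right-continuity then pushes a partition beyond it.
  have hPs : P (sSup S) := by
    rcases eq_or_lt_of_le (zero_le (a := sSup S)) with h | h
    · rw [← h]; exact h0
    · obtain ⟨l, hl⟩ := hx.2 _ h
      have h2 : ∀ᶠ s in 𝓝[<] sSup S, |x s - l| < ε / 2 := by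
        have := hl.sub_const l
        rw [sub_self] at this
        simpa using this.abs.eventually_lt_const (u := ε / 2) (by simpa using hε)
      obtain ⟨a, ha, hsub⟩ := (mem_nhdsLT_iff_exists_Ioo_subset' h).1 h2
      obtain ⟨b, hb, hab⟩ := exists_lt_of_lt_csSup hne ha
      rcases (le_csSup hbdd hb).eq_or_lt with h3 | h3
      · rw [← h3]; exact hb.2
      · refine extend b _ hb.2 h3.le fun s hs1 hs2 => ?_
        have e1 : |x s - l| < ε / 2 := hsub ⟨lt_of_lt_of_le hab hs1, hs2⟩
        have e2 : |x b - l| < ε / 2 := hsub ⟨hab, h3⟩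
        rw [abs_lt] at e1 e2
        rw [abs_le]
        constructor <;> linarith
  have hlt : sSup S < t := hst.lt_of_ne fun h => hcon (h ▸ hPs)
  have h2 : ∀ᶠ s in 𝓝[≥] sSup S, |x s - x (sSup S)| < ε := by
    have := (hx.1 (sSup S)).sub_const (x (sSup S))
    simp only [sub_self] at this
    simpa using this.abs.eventually_lt_const (u := ε) (by simpa using hε)
  obtain ⟨b, hb, hsub⟩ := (mem_nhdsGE_iff_exists_Ico_subset (a := sSup S)).1 h2
  have hb' : sSup S < min b t := lt_min hb hlt
  have : min b t ∈ S := ⟨min_le_right _ _, extend _ _ hPs hb'.le fun s h3 h4 =>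
    (le_of_lt (hsub ⟨h3, h4.trans_le (min_le_left _ _)⟩))⟩
  exact absurd (le_csSup hbdd this) (not_le.2 hb')

lemma exists_bound (hx : IsCadlag x) (t : ℝ≥0) : ∃ K : ℝ, 0 ≤ K ∧ ∀ s ≤ t, |x s| ≤ K := by
  obtain ⟨m, u, ⟨h1, h2, h3⟩, h4⟩ := hx.exists_partition one_pos t
  have : ∀ n ≤ m, ∃ K : ℝ, 0 ≤ K ∧ ∀ s ≤ u n, |x s| ≤ K := by
    intro n
    induction n with
    | zero =>
      intro _
      refine ⟨|x 0|, abs_nonneg _, fun s hs => ?_⟩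
      rw [h2, nonpos_iff_eq_zero] at hs
      rw [hs]
    | succ n ih =>
      intro hn
      obtain ⟨K, hK0, hK⟩ := ih (by omega)
      refine ⟨max (K + 1) |x (u (n + 1))|, by positivity, fun s hs => ?_⟩
      rcases lt_or_ge s (u n) with h | h
      · exact le_max_of_le_left ((hK s h.le).trans (by linarith))
      · rcases hs.lt_or_eq with h' | h'
        · refine le_max_of_le_left ?_
          have e1 := h4 n hn s h h'
          have e2 := hK (u n) le_rfl
          have := abs_add_le (x s - x (u n)) (x (u n))
          rw [sub_add_cancel] at this
          linarith
        · rw [h']; exact le_max_right _ _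
  simpa [h3] using this m le_rfl

lemma measurable (hx : IsCadlag x) : Measurable x := by
  let f : ℕ → ℝ≥0 → ℝ := fun n s => x ((⌊(n + 1 : ℝ≥0) * s⌋₊ + 1) / (n + 1))
  refine measurable_of_tendsto_metrizable (f := f) (fun n => ?_) ?_
  · exact (Measurable.of_discrete (f := fun k : ℕ => x ((k + 1) / (n + 1)))).comp
      (Nat.measurable_floor.comp (measurable_id.const_mul _))
  · rw [tendsto_pi_nhds]
    intro s
    refine (hx.1 s).tendsto.comp (tendsto_nhdsWithin_iff.2 ⟨?_, Eventually.of_forall fun n => ?_⟩)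
    · have h1 : Tendsto (fun n : ℕ => s + 1 / ((n : ℝ≥0) + 1)) atTop (𝓝 (s + 0)) :=
        tendsto_const_nhds.add tendsto_one_div_add_atTop_nhds_zero_nat
      rw [add_zero] at h1
      refine tendsto_of_tendsto_of_tendsto_of_le_of_le tendsto_const_nhds h1 (fun n => ?_)
        fun n => ?_
      · rw [le_div_iff₀ (by positivity), mul_comm]
        exact (Nat.lt_floor_add_one _).le
      · have hn : (n : ℝ≥0) + 1 ≠ 0 := by positivity
        have h2 : (s + 1 / ((n : ℝ≥0) + 1)) = ((n + 1) * s + 1) / (n + 1) := by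
          field_simp
        rw [h2]
        gcongr
        exact Nat.floor_le zero_le
    · rw [mem_Ici, le_div_iff₀ (by positivity), mul_comm]
      exact (Nat.lt_floor_add_one _).le

lemma measurable_leftLim (hx : IsCadlag x) : Measurable (Function.leftLim x) := by
  refine measurable_of_tendsto_metrizable (f := fun (n : ℕ) s => x (s - 1 / ((n : ℝ≥0) + 1)))
    (fun n => hx.measurable.comp (measurable_id.sub_const _)) ?_
  rw [tendsto_pi_nhds]
  intro s
  rcases eq_or_lt_of_le (zero_le (a := s)) with h | h
  · subst h
    -- At `0` the left limit is `x 0` by convention, which agrees with truncated subtraction, `0 - 1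
    -- / (n + 1) = 0`.
    rw [leftLim_eq_of_isBot (a := (0 : ℝ≥0)) fun _ => zero_le]
    simp
  · refine (hx.tendsto_leftLim h).comp (tendsto_nhdsWithin_iff.2
      ⟨?_, Eventually.of_forall fun n => tsub_lt_self h (by positivity)⟩)
    have h1 : Tendsto (fun n : ℕ => s - 1 / ((n : ℝ≥0) + 1)) atTop (𝓝 (s - 0)) :=
      tendsto_const_nhds.sub tendsto_one_div_add_atTop_nhds_zero_nat
    rwa [tsub_zero] at h1

end IsCadlag

/-! ### Bounds, localisation and measurability of the downcrossing count -/

section DownCross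

variable {x : ℝ≥0 → ℝ} {c : ℝ}

lemma disjoint_Ici_Iio_of_pos (hc : 0 < c) (y : ℝ) :
    Disjoint (Ici (y + c / 2)) (Iio (y - c / 2)) :=
  Set.disjoint_left.2 fun a h1 h2 => by simp only [mem_Ici, mem_Iio] at h1 h2; linarith

/-- The number of downcrossings is bounded uniformly in the level. -/
lemma IsCadlag.exists_alternates_bound (hx : IsCadlag x) (hc : 0 < c) (t : ℝ≥0) :
    ∃ N : ℕ, ∀ y n, Alternates x (Ici (y + c / 2)) (Iio (y - c / 2)) n t → n ≤ N := by
  -- Any oscillation below `c / 2` would do: on each block the path then misses one of the two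
  -- thresholds, depending on the side of `y` on which the block starts.
  obtain ⟨m, u, ⟨h1, h2, h3⟩, h4⟩ := hx.exists_partition (ε := c / 3) (by positivity) t
  have : ∀ k ≤ m, ∀ y n, Alternates x (Ici (y + c / 2)) (Iio (y - c / 2)) n (u k) → n ≤ k := by
    intro k
    induction k with
    | zero =>
      rintro - y (_ | n) h
      · exact le_rfl
      · obtain ⟨a, b, -, g2, g3, g4, g5⟩ := h
        rw [h2, nonpos_iff_eq_zero] at g3
        subst g3
        rw [nonpos_iff_eq_zero.1 g2] at g4
        exact absurd g5 (Set.disjoint_left.1 (disjoint_Ici_Iio_of_pos hc y) g4)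
    | succ k ih =>
      rintro hk y (_ | n) h
      · simp
      · refine Nat.succ_le_succ (ih (by omega) y n (h.pred_of_Ico (disjoint_Ici_Iio_of_pos hc y) ?_))
        rcases le_total (x (u k)) y with hy | hy
        · left
          intro r hr1 hr2 hr
          have := (abs_le.1 (h4 k hk r hr1 hr2)).2
          simp only [mem_Ici] at hr
          linarith
        · right
          intro r hr1 hr2 hr
          have := (abs_le.1 (h4 k hk r hr1 hr2)).1
          simp only [mem_Iio] at hr
          linarith
  exact ⟨m, by simpa [h3] using this m le_rfl⟩

lemma IsCadlag.bddAbove_downTime (hx : IsCadlag x) (hc : 0 < c) (t : ℝ≥0) (y : ℝ) :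
    BddAbove {n : ℕ | downTime y c x 0 t n ≤ (t : ℝ≥0∞)} := by
  obtain ⟨N, hN⟩ := hx.exists_alternates_bound hc t
  exact ⟨N, fun n hn => hN y n ((downTime_le_iff hx.1 hc).1 hn)⟩

lemma IsCadlag.le_downCross_iff (hx : IsCadlag x) (hc : 0 < c) {t : ℝ≥0} {y : ℝ} {n : ℕ} :
    n ≤ downCross y c x 0 t ↔ Alternates x (Ici (y + c / 2)) (Iio (y - c / 2)) n t := by
  constructor
  · intro h
    have : downCross y c x 0 t ∈ {n : ℕ | downTime y c x 0 t n ≤ (t : ℝ≥0∞)} :=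
      Nat.sSup_mem ⟨0, by simp [downTime]⟩ (hx.bddAbove_downTime hc t y)
    exact ((downTime_le_iff hx.1 hc).1 this).anti h
  · intro h
    exact le_csSup (hx.bddAbove_downTime hc t y) ((downTime_le_iff hx.1 hc).2 h)

lemma IsCadlag.downCross_mono (hx : IsCadlag x) (hc : 0 < c) {s t : ℝ≥0} (hst : s ≤ t) (y : ℝ) :
    downCross y c x 0 s ≤ downCross y c x 0 t :=
  (hx.le_downCross_iff hc).2 (((hx.le_downCross_iff hc).1 le_rfl).mono_time hst)

lemma IsCadlag.exists_downCross_le (hx : IsCadlag x) (hc : 0 < c) (t : ℝ≥0) :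
    ∃ N : ℕ, ∀ y, downCross y c x 0 t ≤ N :=
  (hx.exists_alternates_bound hc t).imp fun _ h y => h y _ ((hx.le_downCross_iff hc).1 le_rfl)

lemma IsCadlag.downCross_zero (hx : IsCadlag x) (hc : 0 < c) (y : ℝ) :
    downCross y c x 0 0 = 0 := by
  by_contra h
  obtain ⟨a, b, -, g2, g3, g4, g5⟩ := (hx.le_downCross_iff hc).1 (Nat.one_le_iff_ne_zero.2 h)
  rw [nonpos_iff_eq_zero] at g3
  subst g3
  rw [nonpos_iff_eq_zero.1 g2] at g4
  exact Set.disjoint_left.1 (disjoint_Ici_Iio_of_pos hc y) g4 g5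

/-- On `[s, t)` the path stays strictly on one side of `y`, so it misses one threshold. The bound
does not depend on `c`, which makes the localisation work as `c` tends to `0`. -/
lemma IsCadlag.downCross_le_add_one (hx : IsCadlag x) (hc : 0 < c) {s t : ℝ≥0} {y ε : ℝ}
    (h : ∀ r, s ≤ r → r < t → |x r - x s| ≤ ε) (hy : ε < |y - x s|) :
    downCross y c x 0 t ≤ downCross y c x 0 s + 1 := by
  rcases hn : downCross y c x 0 t with _ | n
  · simp
  · refine Nat.succ_le_succ ((hx.le_downCross_iff hc).2 ?_)
    refine ((hx.le_downCross_iff hc).1 hn.ge).pred_of_Ico (disjoint_Ici_Iio_of_pos hc y) ?_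
    rcases lt_abs.1 hy with hy | hy
    · left
      intro r hr1 hr2 hr
      have := (abs_le.1 (h r hr1 hr2)).2
      simp only [mem_Ici] at hr
      linarith
    · right
      intro r hr1 hr2 hr
      have := (abs_le.1 (h r hr1 hr2)).1
      simp only [mem_Iio] at hr
      linarith

lemma IsCadlag.downCross_eq_zero (hx : IsCadlag x) (hc : 0 < c) {t : ℝ≥0} {y K : ℝ}
    (hK : ∀ s ≤ t, |x s| ≤ K) (hy : K < |y|) : downCross y c x 0 t = 0 := by
  by_contra h
  obtain ⟨a, b, -, g2, g3, g4, g5⟩ := (hx.le_downCross_iff hc).1 (Nat.one_le_iff_ne_zero.2 h)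
  have h1 := abs_le.1 (hK a (g2.trans g3))
  have h2 := abs_le.1 (hK b g3)
  simp only [mem_Ici, mem_Iio] at g4 g5
  rcases lt_abs.1 hy with hy | hy <;> linarith

/-- Lowering the level slightly preserves an alternation: the closed upper condition weakens and the
strict lower one leaves room. So each superlevel set contains a left neighbourhood of each of its
points; the reflection `y ↦ -y` matches the criterion for right neighbourhoods. -/
lemma IsCadlag.measurable_downCross (hx : IsCadlag x) (hc : 0 < c) (t : ℝ≥0) :
    Measurable fun y => downCross y c x 0 t := by
  have key : ∀ n : ℕ, ∀ t y, Alternates x (Ici (y + c / 2)) (Iio (y - c / 2)) n t →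
      ∃ δ > 0, ∀ y' ∈ Ioc (y - δ) y, Alternates x (Ici (y' + c / 2)) (Iio (y' - c / 2)) n t := by
    intro n
    induction n with
    | zero => exact fun _ _ _ => ⟨1, one_pos, fun _ _ => trivial⟩
    | succ n ih =>
      rintro t y ⟨a, b, h1, h2, h3, h4, h5⟩
      obtain ⟨δ, hδ, h⟩ := ih a y h1
      simp only [mem_Ici, mem_Iio] at h4 h5
      refine ⟨min δ (y - c / 2 - x b), lt_min hδ (by linarith), fun y' hy' =>
        ⟨a, b, h y' ⟨?_, hy'.2⟩, h2, h3, ?_, ?_⟩⟩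
      · have := min_le_left δ (y - c / 2 - x b)
        linarith [hy'.1]
      · simp only [mem_Ici]; linarith [hy'.2]
      · have := min_le_right δ (y - c / 2 - x b)
        simp only [mem_Iio]
        linarith [hy'.1]
  refine measurable_of_Ici fun n => ?_
  have : MeasurableSet {y : ℝ | n ≤ downCross (-y) c x 0 t} := by
    refine MeasurableSet.of_mem_nhdsGT fun y hy => ?_
    obtain ⟨δ, hδ, h⟩ := key n t (-y) ((hx.le_downCross_iff hc).1 hy)
    refine mem_nhdsGT_iff_exists_Ioo_subset.2 ⟨y + δ, by simpa using hδ, fun z hz => ?_⟩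
    exact (hx.le_downCross_iff hc).2 (h (-z) ⟨by linarith [hz.2], by linarith [hz.1]⟩)
  have h2 := measurable_neg this
  simpa [preimage] using h2

end DownCross

/-! ### Superadditivity of the truncated variations -/

/-- The supremum of `∑ (w (u i) (u (i + 1)))₊` over the partitions of `[0, t]`. -/
noncomputable def partitionSup (w : ℝ≥0 → ℝ≥0 → ℝ) (t : ℝ≥0) : ℝ≥0∞ :=
  ⨆ (n : ℕ) (u : ℕ → ℝ≥0) (_ : IsPartition 0 t n u),
    ∑ i ∈ Finset.range n, ENNReal.ofReal (w (u i) (u (i + 1)))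

lemma sum_le_partitionSup (w : ℝ≥0 → ℝ≥0 → ℝ) {t : ℝ≥0} {n : ℕ} {u : ℕ → ℝ≥0}
    (h : IsPartition 0 t n u) :
    ∑ i ∈ Finset.range n, ENNReal.ofReal (w (u i) (u (i + 1))) ≤ partitionSup w t :=
  le_iSup_of_le n (le_iSup_of_le u (le_iSup_of_le h le_rfl))

lemma partitionSup_le {w : ℝ≥0 → ℝ≥0 → ℝ} {t : ℝ≥0} {b : ℝ≥0∞}
    (h : ∀ n u, IsPartition 0 t n u →
      ∑ i ∈ Finset.range n, ENNReal.ofReal (w (u i) (u (i + 1))) ≤ b) : partitionSup w t ≤ b :=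
  iSup_le fun n => iSup_le fun u => iSup_le fun hu => h n u hu

lemma partitionSup_add_le (w : ℝ≥0 → ℝ≥0 → ℝ) {s t : ℝ≥0} (hst : s ≤ t) :
    partitionSup w s + ENNReal.ofReal (w s t) ≤ partitionSup w t := by
  have key : ∀ n u, IsPartition 0 s n u →
      ∑ i ∈ Finset.range n, ENNReal.ofReal (w (u i) (u (i + 1))) + ENNReal.ofReal (w s t) ≤
        partitionSup w t := by
    rintro n u ⟨h1, h2, h3⟩
    have hp : IsPartition 0 t (n + 1) (fun i => if i ≤ n then u i else t) := by
      refine ⟨monotone_nat_of_le_succ fun i => ?_, by simpa using h2, by simp⟩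
      by_cases hi : i + 1 ≤ n
      · simp [hi, (Nat.le_succ i).trans hi, h1 (Nat.le_succ i)]
      · by_cases hi' : i ≤ n
        · simp only [hi', hi, if_true, if_false]
          exact (h1 hi').trans (h3.le.trans hst)
        · simp [hi, hi']
    refine le_trans (le_of_eq ?_) (sum_le_partitionSup w hp)
    rw [Finset.sum_range_succ]
    congr 1
    · refine Finset.sum_congr rfl fun i hi => ?_
      have := Finset.mem_range.1 hi
      simp [this.le, Nat.succ_le_of_lt this]
    · simp [h3]
  have h0 : ENNReal.ofReal (w s t) ≤ partitionSup w t := by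
    have hp : IsPartition 0 s 1 (fun i => if i = 0 then 0 else s) :=
      ⟨monotone_nat_of_le_succ fun i => by by_cases hi : i = 0 <;> simp [hi], by simp, by simp⟩
    exact le_trans le_add_self (key _ _ hp)
  -- Moving the last term to the other side allows the supremum over partitions of `[0, s]` to be
  -- taken.
  rw [← tsub_add_cancel_of_le h0]
  gcongr
  exact partitionSup_le fun n u hu => ENNReal.le_sub_of_add_le_right ENNReal.ofReal_ne_top (key n u hu)

lemma partitionSup_toReal_add_le {w : ℝ≥0 → ℝ≥0 → ℝ} {s t : ℝ≥0} (hst : s ≤ t)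
    (h : partitionSup w t ≠ ⊤) :
    (partitionSup w s).toReal + max (w s t) 0 ≤ (partitionSup w t).toReal := by
  have h1 := partitionSup_add_le w hst
  have hs : partitionSup w s ≠ ⊤ := ((le_self_add.trans h1).trans_lt h.lt_top).ne
  have h2 := ENNReal.toReal_mono h h1
  rwa [ENNReal.toReal_add hs ENNReal.ofReal_ne_top, ENNReal.toReal_ofReal'] at h2

lemma partitionSup_mono_time (w : ℝ≥0 → ℝ≥0 → ℝ) : Monotone (partitionSup w) :=
  fun _ _ h => le_self_add.trans (partitionSup_add_le w h)

lemma truncVar_eq_partitionSup (c : ℝ) (x : ℝ≥0 → ℝ) (t : ℝ≥0) :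
    truncVar c x 0 t = partitionSup (fun a b => |x b - x a| - c) t := rfl

lemma upTruncVar_eq_partitionSup (c : ℝ) (x : ℝ≥0 → ℝ) (t : ℝ≥0) :
    upTruncVar c x 0 t = partitionSup (fun a b => x b - x a - c) t := rfl

lemma downTruncVar_eq_partitionSup (c : ℝ) (x : ℝ≥0 → ℝ) (t : ℝ≥0) :
    downTruncVar c x 0 t = partitionSup (fun a b => x a - x b - c) t := rfl

lemma downTruncVar_mono_time (c : ℝ) (x : ℝ≥0 → ℝ) : Monotone (downTruncVar c x 0) :=
  partitionSup_mono_time fun a b => x a - x b - c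

/-! ### Indicatrix formula: the truncated variation is at most the integral -/

section Lower

variable {x : ℝ≥0 → ℝ} {c : ℝ}

/-- A partition step that starts at or above `y + c / 2` and ends below `y - c / 2` completes a new
downcrossing. The half-open interval matches these two conventions. -/
lemma IsCadlag.sum_indicator_le_downCross (hx : IsCadlag x) (hc : 0 < c) {u : ℕ → ℝ≥0}
    (hu : Monotone u) (y : ℝ) (n : ℕ) :
    ∑ i ∈ Finset.range n, (Ioc (x (u (i + 1)) + c / 2) (x (u i) - c / 2)).indicator
      (fun _ => (1 : ℕ)) y ≤ downCross y c x 0 (u n) := by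
  induction n with
  | zero => simp
  | succ n ih =>
    rw [Finset.sum_range_succ]
    by_cases hy : y ∈ Ioc (x (u (n + 1)) + c / 2) (x (u n) - c / 2)
    · rw [indicator_of_mem hy]
      refine (Nat.succ_le_succ ih).trans ((hx.le_downCross_iff hc).2 ⟨u n, u (n + 1),
        (hx.le_downCross_iff hc).1 le_rfl, hu (Nat.le_succ n), le_rfl, ?_, ?_⟩)
      · simp only [mem_Ici]; linarith [hy.2]
      · simp only [mem_Iio]; linarith [hy.1]
    · rw [indicator_of_notMem hy, add_zero]
      exact ih.trans (hx.downCross_mono hc (hu (Nat.le_succ n)) y)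

lemma IsCadlag.downTruncVar_le_lintegral (hx : IsCadlag x) (hc : 0 < c) (t : ℝ≥0) :
    downTruncVar c x 0 t ≤ ∫⁻ y, (downCross y c x 0 t : ℝ≥0∞) := by
  rw [downTruncVar_eq_partitionSup]
  refine partitionSup_le ?_
  rintro n u ⟨hu, -, hut⟩
  calc ∑ i ∈ Finset.range n, ENNReal.ofReal (x (u i) - x (u (i + 1)) - c)
      = ∑ i ∈ Finset.range n, ∫⁻ y, (Ioc (x (u (i + 1)) + c / 2) (x (u i) - c / 2)).indicator
          (fun _ => (1 : ℝ≥0∞)) y := by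
        refine Finset.sum_congr rfl fun i _ => ?_
        rw [lintegral_indicator_const measurableSet_Ioc, Real.volume_Ioc, one_mul]
        congr 1
        ring
    _ = ∫⁻ y, ∑ i ∈ Finset.range n, (Ioc (x (u (i + 1)) + c / 2) (x (u i) - c / 2)).indicator
          (fun _ => (1 : ℝ≥0∞)) y := by
        rw [lintegral_finsetSum]
        exact fun i _ => measurable_const.indicator measurableSet_Ioc
    _ ≤ _ := by
        refine lintegral_mono fun y => ?_
        have h := hx.sum_indicator_le_downCross hc hu y n
        rw [hut] at h
        have h2 : ((∑ i ∈ Finset.range n, (Ioc (x (u (i + 1)) + c / 2) (x (u i) - c / 2)).indicator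
          (fun _ => (1 : ℕ)) y : ℕ) : ℝ≥0∞) ≤ (downCross y c x 0 t : ℕ) := by exact_mod_cast h
        refine le_trans (le_of_eq ?_) h2
        rw [Nat.cast_sum]
        refine Finset.sum_congr rfl fun i _ => ?_
        simp only [indicator]
        split_ifs <;> simp

lemma IsCadlag.lintegral_downCross_lt_top (hx : IsCadlag x) (hc : 0 < c) (t : ℝ≥0) :
    ∫⁻ y, (downCross y c x 0 t : ℝ≥0∞) < ⊤ := by
  obtain ⟨N, hN⟩ := hx.exists_downCross_le hc t
  obtain ⟨K, hK0, hK⟩ := hx.exists_bound t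
  refine lt_of_le_of_lt (b := ∫⁻ y, (Icc (-K) K).indicator (fun _ => (N : ℝ≥0∞)) y)
    (lintegral_mono fun y => ?_) ?_
  · by_cases hy : y ∈ Icc (-K) K
    · rw [indicator_of_mem hy]
      exact Nat.cast_le.2 (hN y)
    · rw [hx.downCross_eq_zero hc hK (lt_of_not_ge fun h => hy (abs_le.1 h))]
      simp
  · rw [lintegral_indicator_const measurableSet_Icc, Real.volume_Icc]
    exact ENNReal.mul_lt_top (by simp) (by simp)

lemma IsCadlag.downTruncVar_ne_top (hx : IsCadlag x) (hc : 0 < c) (t : ℝ≥0) :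
    downTruncVar c x 0 t ≠ ⊤ :=
  ((hx.downTruncVar_le_lintegral hc t).trans_lt (hx.lintegral_downCross_lt_top hc t)).ne

end Lower

/-! ### The play operator and its total decrease -/

section Play

/-- The play (hysteresis) operator of width `c`, started at `v 0 - c / 2`. -/
noncomputable def play (c : ℝ) (v : ℕ → ℝ) : ℕ → ℝ
  | 0 => v 0 - c / 2
  | k + 1 => max (v (k + 1) - c / 2) (min (play c v k) (v (k + 1) + c / 2))

/-- The relay at level `y` is on exactly when the play operator exceeds `y`; each alternation
makes it switch off once. -/
lemma Alternates.le_sum_play {c : ℝ} (hc : 0 < c) {v : ℕ → ℝ} {y : ℝ} {n k : ℕ}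
    (h : Alternates v (Ioi (y + c / 2)) (Iio (y - c / 2)) n k) :
    n ≤ ∑ j ∈ Finset.range k, (Ico (play c v (j + 1)) (play c v j)).indicator
      (fun _ => (1 : ℕ)) y := by
  set S : ℕ → ℕ := fun k => ∑ j ∈ Finset.range k,
    (Ico (play c v (j + 1)) (play c v j)).indicator (fun _ => (1 : ℕ)) y with hS
  set on : ℕ → ℕ := fun k => if y < play c v k then 1 else 0 with hon
  -- Switching off moves one unit from `on` to `S`; switching on only adds a unit.
  have hstep : ∀ k, S k + on k ≤ S (k + 1) + on (k + 1) := by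
    intro k
    simp only [hS, hon, Finset.sum_range_succ, indicator, mem_Ico]
    by_cases h1 : y < play c v k <;> by_cases h2 : y < play c v (k + 1)
    · simp [h1, h2]
    · simp [h1, h2, le_of_not_gt h2]
    · simp [h1, h2]
    · simp [h1, h2]
  have hmono : ∀ k, S k ≤ S (k + 1) := fun k => by simp [hS, Finset.sum_range_succ]
  -- The second half counts a visit above `y + c / 2` not yet followed by a descent: the relay is
  -- then either still on or has already been switched off once more.
  have main : ∀ k, (∀ n, Alternates v (Ioi (y + c / 2)) (Iio (y - c / 2)) n k → n ≤ S k) ∧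
      ∀ n a, a ≤ k → Alternates v (Ioi (y + c / 2)) (Iio (y - c / 2)) n a → y + c / 2 < v a →
        n + 1 ≤ S k + on k := by
    intro k
    induction k with
    | zero =>
      have h1 : ∀ n, Alternates v (Ioi (y + c / 2)) (Iio (y - c / 2)) n 0 → n ≤ S 0 := by
        rintro (_ | n) h
        · simp
        · obtain ⟨a, b, -, g2, g3, g4, g5⟩ := h
          obtain rfl : b = 0 := by omega
          obtain rfl : a = 0 := by omega
          simp only [mem_Ioi, mem_Iio] at g4 g5
          linarith
      refine ⟨h1, fun n a ha h hv => ?_⟩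
      obtain rfl : a = 0 := by omega
      have : y < play c v 0 := by simp only [play]; linarith
      simp only [hon, this, if_true]
      exact Nat.succ_le_succ (h1 n h)
    | succ k ih =>
      have h1 : ∀ n, Alternates v (Ioi (y + c / 2)) (Iio (y - c / 2)) n (k + 1) →
          n ≤ S (k + 1) := by
        rintro (_ | n) h
        · simp
        · obtain ⟨a, b, g1, g2, g3, g4, g5⟩ := h
          simp only [mem_Ioi, mem_Iio] at g4 g5
          rcases Nat.lt_or_ge b (k + 1) with hb | hb
          · exact (ih.1 (n + 1) ⟨a, b, g1, g2, by omega, g4, g5⟩).trans (hmono k)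
          · obtain rfl : b = k + 1 := by omega
            have hak : a ≠ k + 1 := by
              rintro rfl
              linarith
            have h2 := (ih.2 n a (by omega) g1 g4).trans (hstep k)
            have h3 : ¬ y < play c v (k + 1) := by
              simp only [play, not_lt]
              refine max_le (by linarith) ((min_le_right _ _).trans (by linarith))
            simpa only [hon, h3, if_false, add_zero] using h2
      refine ⟨h1, fun n a ha h hv => ?_⟩
      rcases Nat.lt_or_ge a (k + 1) with hb | hb
      · exact (ih.2 n a (by omega) h hv).trans (hstep k)
      · obtain rfl : a = k + 1 := by omega
        have : y < play c v (k + 1) := by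
          simp only [play]
          exact lt_max_of_lt_left (by linarith)
        simp only [hon, this, if_true]
        exact Nat.succ_le_succ (h1 n h)
  exact (main k).1 n h

/-- The invariant is that the accumulated decrease plus the current play value is at most `V a + v a
- c / 2` for some earlier index `a`. When the play is pushed up, `a` is reset to the current index.
When it is pushed down to `v (k + 1) + c / 2`, the sum of decrease and value is unchanged, and the
gap `v a - v (k + 1) - c` is exactly what `V` absorbs. -/
lemma sum_play_le {c : ℝ} (hc : 0 < c) {v V : ℕ → ℝ} (hV0 : 0 ≤ V 0) (hVm : Monotone V)
    (hV : ∀ i j, i ≤ j → V i + (v i - v j - c) ≤ V j) (k : ℕ) :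
    ∑ j ∈ Finset.range k, max (play c v j - play c v (j + 1)) 0 ≤ V k := by
  have main : (∑ j ∈ Finset.range k, max (play c v j - play c v (j + 1)) 0 ≤ V k) ∧
      ∃ a ≤ k, ∑ j ∈ Finset.range k, max (play c v j - play c v (j + 1)) 0 + play c v k ≤
        V a + v a - c / 2 := by
    induction k with
    | zero => exact ⟨by simpa using hV0, 0, le_rfl, by simp [play]; linarith⟩
    | succ k ih =>
      obtain ⟨h1, a, hak, h2⟩ := ih
      have hVk := hVm (Nat.le_succ k)
      have hVa := hV a (k + 1) (by omega)
      rw [Finset.sum_range_succ]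
      set W := ∑ j ∈ Finset.range k, max (play c v j - play c v (j + 1)) 0
      have hz : play c v (k + 1) = max (v (k + 1) - c / 2) (min (play c v k) (v (k + 1) + c / 2)) :=
        rfl
      rcases lt_or_ge (play c v k) (v (k + 1) - c / 2) with hlt | hge
      · have e : play c v (k + 1) = v (k + 1) - c / 2 := by
          rw [hz, max_eq_left]
          exact (min_le_left _ _).trans hlt.le
        rw [e, max_eq_right (by linarith), add_zero]
        exact ⟨h1.trans hVk, k + 1, le_rfl, by simp only [Nat.succ_eq_add_one] at hVk; linarith⟩
      · rcases lt_or_ge (v (k + 1) + c / 2) (play c v k) with hlt' | hge'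
        · have e : play c v (k + 1) = v (k + 1) + c / 2 := by
            rw [hz, min_eq_right hlt'.le, max_eq_right (by linarith)]
          rw [e, max_eq_left (by linarith)]
          exact ⟨by linarith, a, by omega, by linarith⟩
        · have e : play c v (k + 1) = play c v k := by
            rw [hz, min_eq_left hge', max_eq_right hge]
          rw [e, sub_self, max_self, add_zero]
          exact ⟨h1.trans hVk, a, by omega, h2⟩
  exact main.1

end Play

/-! ### Indicatrix formula: the integral is at most the truncated variation -/

section Upper

variable {x : ℝ≥0 → ℝ} {c : ℝ}

lemma tendsto_ceil_grid {s t : ℝ≥0} (hst : s ≤ t) :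
    Tendsto (fun m : ℕ => min ((⌈((m : ℝ≥0) + 1) * s⌉₊ : ℝ≥0) / (m + 1)) t) atTop (𝓝[≥] s) := by
  have hge : ∀ m : ℕ, s ≤ (⌈((m : ℝ≥0) + 1) * s⌉₊ : ℝ≥0) / (m + 1) := fun m => by
    rw [le_div_iff₀ (by positivity), mul_comm]
    exact Nat.le_ceil _
  refine tendsto_nhdsWithin_iff.2 ⟨?_, Eventually.of_forall fun m => le_min (hge m) hst⟩
  have h1 : Tendsto (fun n : ℕ => s + 1 / ((n : ℝ≥0) + 1)) atTop (𝓝 (s + 0)) :=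
    tendsto_const_nhds.add tendsto_one_div_add_atTop_nhds_zero_nat
  rw [add_zero] at h1
  refine tendsto_of_tendsto_of_tendsto_of_le_of_le tendsto_const_nhds h1
    (fun m => le_min (hge m) hst) fun m => (min_le_left _ _).trans ?_
  have hn : (m : ℝ≥0) + 1 ≠ 0 := by positivity
  have h2 : (s + 1 / ((m : ℝ≥0) + 1)) = ((m + 1) * s + 1) / (m + 1) := by field_simp
  rw [h2]
  gcongr
  exact (Nat.ceil_lt_add_one zero_le).le

/-- Each visiting time is replaced by the next grid point to its right. Right-continuity and
openness keep the values in `A` and `B` on fine grids; this is why the discrete argument uses two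
strict thresholds. -/
lemma Alternates.eventually_grid (hx : ∀ t, ContinuousWithinAt x (Ici t) t) {A B : Set ℝ}
    (hA : IsOpen A) (hB : IsOpen B) {t : ℝ≥0} {n : ℕ} : ∀ {s : ℝ≥0}, s ≤ t →
    Alternates x A B n s → ∀ᶠ m : ℕ in atTop,
      Alternates (fun j : ℕ => x (min ((j : ℝ≥0) / (m + 1)) t)) A B n ⌈((m : ℝ≥0) + 1) * s⌉₊ := by
  induction n with
  | zero => exact fun _ _ => Eventually.of_forall fun _ => trivial
  | succ n ih =>
    rintro s hs ⟨a, b, h1, h2, h3, h4, h5⟩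
    have hbt := h3.trans hs
    have hat := h2.trans hbt
    filter_upwards [ih hat h1, (hx a).tendsto.comp (tendsto_ceil_grid hat) (hA.mem_nhds h4),
      (hx b).tendsto.comp (tendsto_ceil_grid hbt) (hB.mem_nhds h5)] with m g1 g2 g3
    exact ⟨_, _, g1, Nat.ceil_mono (by gcongr), Nat.ceil_mono (by gcongr), g2, g3⟩

lemma IsCadlag.lintegral_sum_play_le (hx : IsCadlag x) (hc : 0 < c) {t : ℝ≥0} {p : ℕ → ℝ≥0}
    (hp : Monotone p) {k : ℕ} (hk : p k ≤ t) :
    ∫⁻ y, ∑ j ∈ Finset.range k, (Ico (play c (x ∘ p) (j + 1)) (play c (x ∘ p) j)).indicator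
      (fun _ => (1 : ℝ≥0∞)) y ≤ downTruncVar c x 0 t := by
  set z := play c (x ∘ p) with hz
  have hsum : ∑ j ∈ Finset.range k, max (z j - z (j + 1)) 0 ≤
      (downTruncVar c x 0 (p k)).toReal := by
    refine sum_play_le (V := fun j => (downTruncVar c x 0 (p j)).toReal) hc
      ENNReal.toReal_nonneg ?_ ?_ k
    · exact fun i j hij => ENNReal.toReal_mono (hx.downTruncVar_ne_top hc (p j))
        (downTruncVar_mono_time c x (hp hij))
    · intro i j hij
      have h := partitionSup_toReal_add_le (w := fun a b => x a - x b - c) (hp hij)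
        (hx.downTruncVar_ne_top hc (p j))
      have h2 := le_max_left (x (p i) - x (p j) - c) 0
      simp only [downTruncVar_eq_partitionSup, Function.comp_apply]
      linarith
  calc _ = ∑ j ∈ Finset.range k, ENNReal.ofReal (z j - z (j + 1)) := by
        rw [lintegral_finsetSum _ fun j _ => measurable_const.indicator measurableSet_Ico]
        refine Finset.sum_congr rfl fun j _ => ?_
        rw [lintegral_indicator_const measurableSet_Ico, Real.volume_Ico, one_mul]
    _ = ENNReal.ofReal (∑ j ∈ Finset.range k, max (z j - z (j + 1)) 0) := by
        rw [ENNReal.ofReal_sum_of_nonneg fun _ _ => le_max_right _ _]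
        refine Finset.sum_congr rfl fun j _ => ?_
        rw [ENNReal.ofReal_max, ENNReal.ofReal_zero, max_eq_left zero_le]
    _ ≤ ENNReal.ofReal (downTruncVar c x 0 (p k)).toReal := ENNReal.ofReal_le_ofReal hsum
    _ = downTruncVar c x 0 (p k) := ENNReal.ofReal_toReal (hx.downTruncVar_ne_top hc _)
    _ ≤ _ := downTruncVar_mono_time c x hk

/-- Fatou's lemma is used twice: over refining grids, for crossings with strict thresholds, and over
small downward shifts of the level, to recover the closed upper threshold. Translation invariance
makes the shifts free. -/
lemma IsCadlag.lintegral_downCross_le (hx : IsCadlag x) (hc : 0 < c) (t : ℝ≥0) :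
    ∫⁻ y, (downCross y c x 0 t : ℝ≥0∞) ≤ downTruncVar c x 0 t := by
  let p : ℕ → ℕ → ℝ≥0 := fun m j => min ((j : ℝ≥0) / (m + 1)) t
  have hp : ∀ m, Monotone (p m) := fun m i j hij => by
    simp only [p]
    gcongr
  let z : ℕ → ℕ → ℝ := fun m => play c (x ∘ p m)
  let r : ℕ → ℝ → ℝ≥0∞ := fun m y => ∑ j ∈ Finset.range ⌈((m : ℝ≥0) + 1) * t⌉₊,
    (Ico (z m (j + 1)) (z m j)).indicator (fun _ => (1 : ℝ≥0∞)) y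
  have hr : ∀ m, Measurable (r m) := fun m =>
    Finset.measurable_fun_sum _ fun j _ => measurable_const.indicator measurableSet_Ico
  have hrint : ∀ m, ∫⁻ y, r m y ≤ downTruncVar c x 0 t := fun m =>
    hx.lintegral_sum_play_le hc (hp m) (min_le_right _ _)
  have hE : ∫⁻ y, liminf (fun m => r m y) atTop ≤ downTruncVar c x 0 t :=
    (lintegral_liminf_le hr).trans (liminf_le_of_le (by isBoundedDefault) fun b hb => by
      obtain ⟨m, hm⟩ := hb.exists
      exact hm.trans (hrint m))
  set E : ℝ → ℝ≥0∞ := fun y => liminf (fun m => r m y) atTop with hEdef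
  have hEm : Measurable E := Measurable.liminf hr
  have hdE : ∀ y n, Alternates x (Ioi (y + c / 2)) (Iio (y - c / 2)) n t → (n : ℝ≥0∞) ≤ E y := by
    intro y n h
    refine le_liminf_of_le (by isBoundedDefault) ?_
    filter_upwards [h.eventually_grid hx.1 isOpen_Ioi isOpen_Iio le_rfl] with m hm
    have h2 := hm.le_sum_play hc
    refine (Nat.cast_le.2 h2).trans (le_of_eq ?_)
    rw [Nat.cast_sum]
    refine Finset.sum_congr rfl fun i _ => ?_
    change _ = (Ico (play c (fun j => x (min ((j : ℝ≥0) / (m + 1)) t)) (i + 1))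
      (play c (fun j => x (min ((j : ℝ≥0) / (m + 1)) t)) i)).indicator _ y
    simp only [indicator]
    split_ifs <;> simp
  -- A visit at or above `y + c / 2` is strictly above the lowered threshold, while the strict lower
  -- inequality tolerates a small `δ`.
  have hshift : ∀ n : ℕ, ∀ t y, Alternates x (Ici (y + c / 2)) (Iio (y - c / 2)) n t →
      ∀ᶠ δ in 𝓝[>] (0 : ℝ), Alternates x (Ioi (y - δ + c / 2)) (Iio (y - δ - c / 2)) n t := by
    intro n
    induction n with
    | zero => exact fun _ _ _ => Eventually.of_forall fun _ => trivial
    | succ n ih =>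
      rintro t y ⟨a, b, h1, h2, h3, h4, h5⟩
      simp only [mem_Ici, mem_Iio] at h4 h5
      filter_upwards [ih a y h1, Ioo_mem_nhdsGT (show 0 < y - c / 2 - x b by linarith)] with δ g1 g2
      refine ⟨a, b, g1, h2, h3, ?_, ?_⟩
      · simp only [mem_Ioi]; linarith [g2.1]
      · simp only [mem_Iio]; linarith [g2.2]
  have hlim : Tendsto (fun j : ℕ => 1 / ((j : ℝ) + 1)) atTop (𝓝[>] 0) :=
    tendsto_nhdsWithin_iff.2 ⟨tendsto_one_div_add_atTop_nhds_zero_nat,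
      Eventually.of_forall fun j => by simp only [mem_Ioi]; positivity⟩
  calc ∫⁻ y, (downCross y c x 0 t : ℝ≥0∞)
      ≤ ∫⁻ y, liminf (fun j : ℕ => E (y - 1 / ((j : ℝ) + 1))) atTop := by
        refine lintegral_mono fun y => le_liminf_of_le (by isBoundedDefault) ?_
        filter_upwards [hlim.eventually
          (hshift _ t y ((hx.le_downCross_iff hc).1 le_rfl))] with j hj
        exact hdE _ _ hj
    _ ≤ liminf (fun j : ℕ => ∫⁻ y, E (y - 1 / ((j : ℝ) + 1))) atTop :=
        lintegral_liminf_le fun j => hEm.comp (measurable_id.sub_const _)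
    _ = ∫⁻ y, E y := by simp only [lintegral_sub_right_eq_self, liminf_const]
    _ ≤ _ := hE

/-- The Banach indicatrix formula for the truncated variation. -/
lemma IsCadlag.lintegral_downCross (hx : IsCadlag x) (hc : 0 < c) (t : ℝ≥0) :
    ∫⁻ y, (downCross y c x 0 t : ℝ≥0∞) = downTruncVar c x 0 t :=
  (hx.lintegral_downCross_le hc t).antisymm (hx.downTruncVar_le_lintegral hc t)

lemma IsCadlag.integrable_downCross (hx : IsCadlag x) (hc : 0 < c) (t : ℝ≥0) :
    Integrable fun y => (downCross y c x 0 t : ℝ) := by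
  refine ⟨(measurable_from_nat.comp (hx.measurable_downCross hc t)).aestronglyMeasurable, ?_⟩
  simpa [HasFiniteIntegral] using hx.lintegral_downCross_lt_top hc t

lemma IsCadlag.integral_downCross (hx : IsCadlag x) (hc : 0 < c) (t : ℝ≥0) :
    ∫ y, (downCross y c x 0 t : ℝ) = (downTruncVar c x 0 t).toReal := by
  rw [← hx.lintegral_downCross hc, integral_eq_lintegral_of_nonneg_ae
    (Eventually.of_forall fun y => Nat.cast_nonneg _)
    (hx.integrable_downCross hc t).aestronglyMeasurable]
  simp

end Upper

/-! ### Comparison of the three truncated variations -/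

section Comparison

variable {x : ℝ≥0 → ℝ} {c : ℝ}

lemma upTruncVar_eq_downTruncVar_neg (c : ℝ) (x : ℝ≥0 → ℝ) (t : ℝ≥0) :
    upTruncVar c x 0 t = downTruncVar c (fun u => -x u) 0 t := by
  rw [upTruncVar_eq_partitionSup, downTruncVar_eq_partitionSup]
  congr 1
  funext a b
  ring

lemma truncVar_neg (c : ℝ) (x : ℝ≥0 → ℝ) (t : ℝ≥0) :
    truncVar c (fun u => -x u) 0 t = truncVar c x 0 t := by
  rw [truncVar_eq_partitionSup, truncVar_eq_partitionSup]
  congr 1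
  funext a b
  rw [← abs_neg]
  congr 2
  ring

lemma truncVar_le_add (c : ℝ) (x : ℝ≥0 → ℝ) (t : ℝ≥0) :
    truncVar c x 0 t ≤ upTruncVar c x 0 t + downTruncVar c x 0 t := by
  rw [truncVar_eq_partitionSup, upTruncVar_eq_partitionSup, downTruncVar_eq_partitionSup]
  refine partitionSup_le fun n u hu => ?_
  refine le_trans ?_ (add_le_add (sum_le_partitionSup (fun a b => x b - x a - c) hu)
    (sum_le_partitionSup (fun a b => x a - x b - c) hu))
  rw [← Finset.sum_add_distrib]
  refine Finset.sum_le_sum fun i _ => ?_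
  rcases abs_cases (x (u (i + 1)) - x (u i)) with ⟨h, -⟩ | ⟨h, -⟩ <;> rw [h]
  · exact le_self_add
  · rw [neg_sub]; exact le_add_self

lemma IsCadlag.upTruncVar_ne_top (hx : IsCadlag x) (hc : 0 < c) (t : ℝ≥0) :
    upTruncVar c x 0 t ≠ ⊤ := by
  rw [upTruncVar_eq_downTruncVar_neg]
  exact hx.neg.downTruncVar_ne_top hc t

lemma IsCadlag.truncVar_ne_top (hx : IsCadlag x) (hc : 0 < c) (t : ℝ≥0) :
    truncVar c x 0 t ≠ ⊤ :=
  ((truncVar_le_add c x t).trans_lt (ENNReal.add_lt_top.2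
    ⟨(hx.upTruncVar_ne_top hc t).lt_top, (hx.downTruncVar_ne_top hc t).lt_top⟩)).ne

/-- The drops of `x` along a partition are controlled by any functional that dominates the rises
of `x` (and the drops as well, if `1 < l`). -/
lemma mul_sum_drop_le {V : ℝ≥0 → ℝ} {l K : ℝ} (hl : 1 ≤ l) {t : ℝ≥0}
    (hK : ∀ s ≤ t, |x s| ≤ K) (hV0 : 0 ≤ V 0)
    (hup : ∀ a b, a ≤ b → b ≤ t → V a + (x b - x a - c) ≤ V b)
    (hdown : ∀ a b, a ≤ b → b ≤ t → V a + (l - 1) * max (x a - x b - c) 0 ≤ V b)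
    {n : ℕ} {u : ℕ → ℝ≥0} (hu : IsPartition 0 t n u) :
    l * ∑ i ∈ Finset.range n, max (x (u i) - x (u (i + 1)) - c) 0 ≤ V t + 2 * K := by
  obtain ⟨hm, h0, hn⟩ := hu
  have hut : ∀ k ≤ n, u k ≤ t := fun k hk => hn ▸ hm hk
  have hVm : ∀ a b, a ≤ b → b ≤ t → V a ≤ V b := fun a b hab hb => by
    have := hdown a b hab hb
    have h2 : 0 ≤ (l - 1) * max (x a - x b - c) 0 :=
      mul_nonneg (by linarith) (le_max_right _ _)
    linarith
  -- The time `b` is the end of the last nonzero drop, or `0` if there is none.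
  have main : ∀ k ≤ n, ∃ b ≤ u k,
      l * ∑ i ∈ Finset.range k, max (x (u i) - x (u (i + 1)) - c) 0 ≤ K + V b - x b := by
    intro k
    induction k with
    | zero =>
      intro _
      refine ⟨0, zero_le, ?_⟩
      have := (abs_le.1 (hK 0 zero_le)).2
      simp only [Finset.range_zero, Finset.sum_empty, mul_zero]
      linarith
    | succ k ih =>
      intro hk
      obtain ⟨b, hb, h⟩ := ih (by omega)
      have hkk := hm (Nat.le_succ k)
      rw [Finset.sum_range_succ, mul_add]
      rcases le_or_gt (x (u k) - x (u (k + 1)) - c) 0 with hle | hgt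
      · refine ⟨b, hb.trans hkk, ?_⟩
        rw [max_eq_right hle, mul_zero, add_zero]
        exact h
      · refine ⟨u (k + 1), le_rfl, ?_⟩
        -- One of the `l` copies of the drop is combined with the preceding rise: its `-c` is the
        -- one needed for `V` to dominate that rise. The other `l - 1` copies are charged to `V`
        -- over the drop itself.
        have h1 := hup b (u k) hb (hut k (by omega))
        have h2 := hdown (u k) (u (k + 1)) hkk (hut _ hk)
        rw [max_eq_left hgt.le] at h2 ⊢
        linarith
  obtain ⟨b, hb, h⟩ := main n le_rfl
  rw [hn] at hb
  have h1 := hVm b t hb le_rfl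
  have h2 := (abs_le.1 (hK b hb)).1
  linarith

lemma toReal_partitionSup_le {w : ℝ≥0 → ℝ≥0 → ℝ} {t : ℝ≥0} {B : ℝ} (hB : 0 ≤ B)
    (h : ∀ n u, IsPartition 0 t n u →
      ∑ i ∈ Finset.range n, max (w (u i) (u (i + 1))) 0 ≤ B) : (partitionSup w t).toReal ≤ B := by
  refine ENNReal.toReal_le_of_le_ofReal hB (partitionSup_le fun n u hu => ?_)
  refine le_trans (le_of_eq ?_) (ENNReal.ofReal_le_ofReal (h n u hu))
  rw [ENNReal.ofReal_sum_of_nonneg fun _ _ => le_max_right _ _]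
  refine Finset.sum_congr rfl fun j _ => ?_
  rw [ENNReal.ofReal_max, ENNReal.ofReal_zero, max_eq_left zero_le]

lemma IsCadlag.downTruncVar_le_upTruncVar_add (hx : IsCadlag x) (hc : 0 < c) {t : ℝ≥0} {K : ℝ}
    (hK : ∀ s ≤ t, |x s| ≤ K) :
    (downTruncVar c x 0 t).toReal ≤ (upTruncVar c x 0 t).toReal + 2 * K := by
  have hK0 : 0 ≤ K := (abs_nonneg _).trans (hK 0 zero_le)
  rw [downTruncVar_eq_partitionSup]
  refine toReal_partitionSup_le (by positivity) fun n u hu => ?_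
  have := mul_sum_drop_le (c := c) (V := fun s => (upTruncVar c x 0 s).toReal) le_rfl hK
    ENNReal.toReal_nonneg (fun a b hab hb => ?_) (fun a b hab hb => ?_) hu
  · simpa using this
  · exact le_trans (add_le_add_right (le_max_left _ 0) _) (partitionSup_toReal_add_le
      (w := fun a b => x b - x a - c) hab (hx.upTruncVar_ne_top hc b))
  · rw [sub_self, zero_mul, add_zero]
    exact ENNReal.toReal_mono (hx.upTruncVar_ne_top hc b)
      (partitionSup_mono_time (fun a b => x b - x a - c) hab)

lemma IsCadlag.two_mul_downTruncVar_le_truncVar_add (hx : IsCadlag x) (hc : 0 < c) {t : ℝ≥0}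
    {K : ℝ} (hK : ∀ s ≤ t, |x s| ≤ K) :
    2 * (downTruncVar c x 0 t).toReal ≤ (truncVar c x 0 t).toReal + 2 * K := by
  have hK0 : 0 ≤ K := (abs_nonneg _).trans (hK 0 zero_le)
  have hV : ∀ a b, a ≤ b → (truncVar c x 0 a).toReal + max (|x b - x a| - c) 0 ≤
      (truncVar c x 0 b).toReal := fun a b hab => partitionSup_toReal_add_le
    (w := fun a b => |x b - x a| - c) hab (hx.truncVar_ne_top hc b)
  suffices (downTruncVar c x 0 t).toReal ≤ ((truncVar c x 0 t).toReal + 2 * K) / 2 by linarith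
  rw [downTruncVar_eq_partitionSup]
  refine toReal_partitionSup_le (by positivity) fun n u hu => ?_
  have := mul_sum_drop_le (c := c) (V := fun s => (truncVar c x 0 s).toReal) one_le_two hK
    ENNReal.toReal_nonneg (fun a b hab hb => ?_) (fun a b hab hb => ?_) hu
  · linarith
  · have h1 := hV a b hab
    have h2 := le_abs_self (x b - x a)
    have h3 := le_max_left (|x b - x a| - c) 0
    linarith
  · refine le_trans ?_ (hV a b hab)
    have h2 := neg_le_abs (x b - x a)
    rw [show (2 : ℝ) - 1 = 1 by norm_num, one_mul]
    gcongr
    linarith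

/-- Alternation forces rises and drops to balance up to the range of `x`. The lower bound is the
case `l = 2` of `mul_sum_drop_le` with TV; the upper bound combines TV ≤ UTV + DTV with the case `l
= 1` for `-x`. -/
lemma IsCadlag.abs_truncVar_sub_le (hx : IsCadlag x) (hc : 0 < c) {t : ℝ≥0} {K : ℝ}
    (hK : ∀ s ≤ t, |x s| ≤ K) :
    |(truncVar c x 0 t).toReal - 2 * (downTruncVar c x 0 t).toReal| ≤ 2 * K := by
  have h1 := hx.two_mul_downTruncVar_le_truncVar_add hc hK
  have h2 := hx.neg.downTruncVar_le_upTruncVar_add (K := K) hc (t := t) (by simpa using hK)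
  rw [← upTruncVar_eq_downTruncVar_neg, upTruncVar_eq_downTruncVar_neg c fun u => -x u] at h2
  simp only [neg_neg] at h2
  have h3 := ENNReal.toReal_mono (ENNReal.add_ne_top.2
    ⟨hx.upTruncVar_ne_top hc t, hx.downTruncVar_ne_top hc t⟩) (truncVar_le_add c x t)
  rw [ENNReal.toReal_add (hx.upTruncVar_ne_top hc t) (hx.downTruncVar_ne_top hc t)] at h3
  rw [abs_le]
  constructor <;> linarith

lemma tendsto_mul_iff_of_bounded_sub {φ f g : ℝ → ℝ} {C a : ℝ}
    (hφ : Tendsto φ (𝓝[>] 0) (𝓝 0)) (h : ∀ c, 0 < c → |f c - g c| ≤ C) :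
    Tendsto (fun c => φ c * f c) (𝓝[>] 0) (𝓝 a) ↔ Tendsto (fun c => φ c * g c) (𝓝[>] 0) (𝓝 a) := by
  have h0 : Tendsto (fun c => φ c * (f c - g c)) (𝓝[>] 0) (𝓝 0) := by
    refine squeeze_zero_norm' ?_ (by simpa using hφ.abs.mul_const C)
    filter_upwards [self_mem_nhdsWithin] with c hc
    rw [norm_mul, Real.norm_eq_abs, Real.norm_eq_abs]
    gcongr
    exact h c hc
  constructor
  · intro hf
    simpa [mul_sub] using hf.sub h0
  · intro hg
    simpa [mul_sub] using hg.add h0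

lemma IsCadlag.tendsto_truncVar_iff (hx : IsCadlag x) {φ : ℝ → ℝ}
    (hφ : Tendsto φ (𝓝[>] 0) (𝓝 0)) {t : ℝ≥0} {a : ℝ} :
    Tendsto (fun c => φ c * (truncVar c x 0 t).toReal) (𝓝[>] 0) (𝓝 a) ↔
      Tendsto (fun c => 2 * φ c * (downTruncVar c x 0 t).toReal) (𝓝[>] 0) (𝓝 a) := by
  obtain ⟨K, -, hK⟩ := hx.exists_bound t
  rw [tendsto_mul_iff_of_bounded_sub hφ fun c hc => hx.abs_truncVar_sub_le hc hK]
  simp only [← mul_assoc, mul_comm _ (2 : ℝ)]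

lemma IsCadlag.tendsto_truncVar_iff_up (hx : IsCadlag x) {φ : ℝ → ℝ}
    (hφ : Tendsto φ (𝓝[>] 0) (𝓝 0)) {t : ℝ≥0} {a : ℝ} :
    Tendsto (fun c => φ c * (truncVar c x 0 t).toReal) (𝓝[>] 0) (𝓝 a) ↔
      Tendsto (fun c => 2 * φ c * (upTruncVar c x 0 t).toReal) (𝓝[>] 0) (𝓝 a) := by
  have := hx.neg.tendsto_truncVar_iff hφ (t := t) (a := a)
  simpa only [truncVar_neg, ← upTruncVar_eq_downTruncVar_neg] using this

end Comparison

/-! ### Localisation to blocks of small oscillation -/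

section Estimates

variable {x ζ : ℝ≥0 → ℝ} {c : ℝ} {g : ℝ → ℝ}

lemma IsCadlag.integrable_downCross_mul (hx : IsCadlag x) (hc : 0 < c) (hg : Continuous g)
    (t : ℝ≥0) : Integrable fun y => (downCross y c x 0 t : ℝ) * g y := by
  obtain ⟨K, -, hK⟩ := hx.exists_bound t
  obtain ⟨G, hG⟩ := isCompact_Icc.exists_bound_of_continuousOn (s := Icc (-K) K) hg.continuousOn
  have hd := hx.integrable_downCross hc t
  refine (hd.mul_const G).mono' (hd.aestronglyMeasurable.mul hg.aestronglyMeasurable)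
    (Eventually.of_forall fun y => ?_)
  rw [norm_mul, Real.norm_natCast]
  by_cases hy : y ∈ Icc (-K) K
  · gcongr
    exact hG y hy
  · rw [hx.downCross_eq_zero hc hK (lt_of_not_ge fun h => hy (abs_le.1 h))]
    simp

/-- On each block, levels within `ε` of `x (u i)` cost at most `ω` per new crossing. The others gain
at most one crossing and cost at most `2 * G` on an interval of length `2 * K`, hence `4 * G * K`.
This second error does not depend on `c`. -/
lemma IsCadlag.abs_integral_downCross_mul_sub_sum_le (hx : IsCadlag x) (hc : 0 < c) {m : ℕ}
    {u : ℕ → ℝ≥0} (hu : Monotone u) (hu0 : u 0 = 0) {ε K G ω : ℝ}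
    (hosc : ∀ i < m, ∀ s, u i ≤ s → s < u (i + 1) → |x s - x (u i)| ≤ ε)
    (hK : ∀ s ≤ u m, |x s| ≤ K) (hg : Continuous g) (hG : ∀ y ∈ Icc (-K) K, |g y| ≤ G)
    (hω0 : 0 ≤ ω) (hω : ∀ y ∈ Icc (-K) K, ∀ z ∈ Icc (-K) K, |y - z| ≤ ε → |g y - g z| ≤ ω) :
    |(∫ y, (downCross y c x 0 (u m) : ℝ) * g y) - ∑ i ∈ Finset.range m, g (x (u i)) *
      ((downTruncVar c x 0 (u (i + 1))).toReal - (downTruncVar c x 0 (u i)).toReal)| ≤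
      ω * (downTruncVar c x 0 (u m)).toReal + m * (4 * G * K) := by
  have hK0 : 0 ≤ K := (abs_nonneg _).trans (hK 0 zero_le)
  have main : ∀ n ≤ m, |(∫ y, (downCross y c x 0 (u n) : ℝ) * g y) - ∑ i ∈ Finset.range n,
      g (x (u i)) *
      ((downTruncVar c x 0 (u (i + 1))).toReal - (downTruncVar c x 0 (u i)).toReal)| ≤
      ω * (downTruncVar c x 0 (u n)).toReal + n * (4 * G * K) := by
    intro n
    induction n with
    | zero =>
      intro _
      simp only [hu0, hx.downCross_zero hc]
      simpa using mul_nonneg hω0 ENNReal.toReal_nonneg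
    | succ n ih =>
      intro hn
      have h := ih (by omega)
      have hle := hu (Nat.le_succ n)
      have hun : ∀ s ≤ u (n + 1), |x s| ≤ K := fun s hs => hK s (hs.trans (hu hn))
      have hxn : x (u n) ∈ Icc (-K) K := abs_le.1 (hun _ hle)
      set d : ℝ → ℝ := fun y => downCross y c x 0 (u n)
      set d' : ℝ → ℝ := fun y => downCross y c x 0 (u (n + 1))
      have hd : Integrable d := hx.integrable_downCross hc _
      have hd' : Integrable d' := hx.integrable_downCross hc _
      have hdg : Integrable fun y => d y * g y := hx.integrable_downCross_mul hc hg _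
      have hdg' : Integrable fun y => d' y * g y := hx.integrable_downCross_mul hc hg _
      have hDD : ∫ y, (d' y - d y) = (downTruncVar c x 0 (u (n + 1))).toReal -
          (downTruncVar c x 0 (u n)).toReal := by
        rw [integral_sub hd' hd, hx.integral_downCross hc, hx.integral_downCross hc]
      have hpt : ∀ y, |(d' y - d y) * (g y - g (x (u n)))| ≤
          ω * (d' y - d y) + (Icc (-K) K).indicator (fun _ => 2 * G) y := by
        intro y
        have hmono : d y ≤ d' y := Nat.cast_le.2 (hx.downCross_mono hc hle y)
        rw [abs_mul, abs_of_nonneg (sub_nonneg.2 hmono), mul_comm]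
        by_cases hy : y ∈ Icc (-K) K
        · rw [indicator_of_mem hy]
          have hG0 : 0 ≤ 2 * G := by linarith [(abs_nonneg _).trans (hG y hy)]
          rcases le_or_gt |y - x (u n)| ε with h1 | h1
          · refine le_trans ?_ (le_add_of_nonneg_right hG0)
            gcongr
            exact hω y hy _ hxn h1
          · have h2 : d' y ≤ d y + 1 := by
              have := Nat.cast_le (α := ℝ).2 (hx.downCross_le_add_one hc (hosc n hn) h1)
              rwa [Nat.cast_add, Nat.cast_one] at this
            have h3 : |g y - g (x (u n))| ≤ 2 * G := by
              have := abs_sub (g y) (g (x (u n)))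
              linarith [hG y hy, hG _ hxn]
            calc |g y - g (x (u n))| * (d' y - d y) ≤ 2 * G * 1 := by
                  gcongr
                  linarith
              _ ≤ _ := by
                  rw [mul_one]
                  exact le_add_of_nonneg_left (mul_nonneg hω0 (sub_nonneg.2 hmono))
        · have hy' := lt_of_not_ge fun h => hy (abs_le.1 h)
          have h1 : d' y = 0 := Nat.cast_eq_zero.2 (hx.downCross_eq_zero hc hun hy')
          have h2 : d y = 0 := Nat.cast_eq_zero.2
            (hx.downCross_eq_zero hc (fun s hs => hun s (hs.trans hle)) hy')
          rw [indicator_of_notMem hy, h1, h2, sub_self, mul_zero, mul_zero, add_zero]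
      have hsub : Integrable fun y => d' y - d y := hd'.sub hd
      have hωsub : Integrable fun y => ω * (d' y - d y) := hsub.const_mul ω
      have hgsub : Integrable fun y => g (x (u n)) * (d' y - d y) := hsub.const_mul _
      have hdgsub : Integrable fun y => d' y * g y - d y * g y := hdg'.sub hdg
      have hind : Integrable fun y => (Icc (-K) K).indicator (fun _ : ℝ => 2 * G) y :=
        (integrable_indicator_iff measurableSet_Icc).2 (integrableOn_const (by simp))
      have hsum : Integrable fun y =>
          ω * (d' y - d y) + (Icc (-K) K).indicator (fun _ : ℝ => 2 * G) y := hωsub.add hind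
      have hstep : |∫ y, (d' y - d y) * (g y - g (x (u n)))| ≤
          ω * ((downTruncVar c x 0 (u (n + 1))).toReal - (downTruncVar c x 0 (u n)).toReal) +
            4 * G * K := by
        have e : ∫ y, (ω * (d' y - d y) + (Icc (-K) K).indicator (fun _ => 2 * G) y) =
            ω * ((downTruncVar c x 0 (u (n + 1))).toReal - (downTruncVar c x 0 (u n)).toReal) +
            4 * G * K := by
          rw [integral_add hωsub hind, integral_const_mul, hDD,
            integral_indicator_const _ measurableSet_Icc, Real.volume_real_Icc_of_le (by linarith),
            smul_eq_mul]
          ring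
        rw [← e]
        exact norm_integral_le_of_norm_le
          (f := fun y => (d' y - d y) * (g y - g (x (u n)))) hsum (Eventually.of_forall hpt)
      have hsplit : ∫ y, (d' y - d y) * (g y - g (x (u n))) =
          (∫ y, d' y * g y) - (∫ y, d y * g y) - g (x (u n)) *
            ((downTruncVar c x 0 (u (n + 1))).toReal - (downTruncVar c x 0 (u n)).toReal) := by
        rw [← hDD, ← integral_const_mul, ← integral_sub hdg' hdg,
          ← integral_sub hdgsub hgsub]
        refine integral_congr_ae (Eventually.of_forall fun y => ?_)
        simp only
        ring
      rw [Finset.sum_range_succ]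
      rw [hsplit] at hstep
      push_cast
      rw [abs_le] at h hstep ⊢
      constructor <;> linarith [h.1, h.2, hstep.1, hstep.2]
  exact main m le_rfl

/-- The right endpoint `b` is included although `x b` may be far away: the left limit sees only
times before `b`. -/
lemma abs_leftLim_sub_le (hx : IsCadlag x) {a b s : ℝ≥0} {ε : ℝ}
    (h : ∀ s, a ≤ s → s < b → |x s - x a| ≤ ε) (hs : s ∈ Ioc a b) :
    |Function.leftLim x s - x a| ≤ ε := by
  have h1 := ((hx.tendsto_leftLim (zero_le.trans_lt hs.1)).sub_const (x a)).abs
  have : (𝓝[<] s).NeBot := nhdsLT_neBot_of_exists_lt ⟨a, hs.1⟩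
  refine le_of_tendsto h1 ?_
  filter_upwards [Ioo_mem_nhdsLT hs.1] with r hr
  exact h r hr.1.le (hr.2.trans_le hs.2)

lemma abs_leftLim_le (hx : IsCadlag x) {s t : ℝ≥0} {K : ℝ} (hK : ∀ s ≤ t, |x s| ≤ K)
    (hs : s ∈ Ioc 0 t) : |Function.leftLim x s| ≤ K := by
  have h1 := (hx.tendsto_leftLim hs.1).abs
  have : (𝓝[<] s).NeBot := nhdsLT_neBot_of_exists_lt ⟨0, hs.1⟩
  refine le_of_tendsto h1 ?_
  filter_upwards [self_mem_nhdsWithin] with r hr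
  exact hK r (le_of_lt (lt_of_lt_of_le hr hs.2))

lemma stieltjesMeasure_Ioc (hm : Monotone ζ) (hζ : IsCadlag ζ) (a b : ℝ≥0) :
    stieltjesMeasure ζ hm hζ (Ioc a b) = ENNReal.ofReal (ζ b - ζ a) :=
  StieltjesFunction.measure_Ioc _ a b

lemma stieltjesMeasure_real_Ioc (hm : Monotone ζ) (hζ : IsCadlag ζ) {a b : ℝ≥0} (hab : a ≤ b) :
    (stieltjesMeasure ζ hm hζ).real (Ioc a b) = ζ b - ζ a := by
  rw [Measure.real, stieltjesMeasure_Ioc, ENNReal.toReal_ofReal (sub_nonneg.2 (hm hab))]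

lemma integrableOn_comp_leftLim (hx : IsCadlag x) (hm : Monotone ζ) (hζ : IsCadlag ζ)
    (hg : Continuous g) (t : ℝ≥0) :
    IntegrableOn (fun s => g (Function.leftLim x s)) (Ioc 0 t) (stieltjesMeasure ζ hm hζ) := by
  obtain ⟨K, -, hK⟩ := hx.exists_bound t
  obtain ⟨G, hG⟩ := isCompact_Icc.exists_bound_of_continuousOn (s := Icc (-K) K) hg.continuousOn
  refine IntegrableOn.of_bound (by rw [stieltjesMeasure_Ioc]; exact ENNReal.ofReal_lt_top)
    (hg.measurable.comp hx.measurable_leftLim).aestronglyMeasurable G ?_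
  exact (ae_restrict_mem measurableSet_Ioc).mono fun s hs =>
    hG _ (abs_le.1 (abs_leftLim_le hx hK hs))

lemma setIntegral_Ioc_succ (hx : IsCadlag x) (hm : Monotone ζ) (hζ : IsCadlag ζ)
    (hg : Continuous g) {a b : ℝ≥0} (hab : a ≤ b) :
    ∫ s in Ioc 0 b, g (Function.leftLim x s) ∂(stieltjesMeasure ζ hm hζ) =
      ∫ s in Ioc 0 a, g (Function.leftLim x s) ∂(stieltjesMeasure ζ hm hζ) +
      ∫ s in Ioc a b, g (Function.leftLim x s) ∂(stieltjesMeasure ζ hm hζ) := by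
  have hi := integrableOn_comp_leftLim hx hm hζ hg b
  rw [← Ioc_union_Ioc_eq_Ioc zero_le hab, setIntegral_union (Ioc_disjoint_Ioc_of_le le_rfl)
    measurableSet_Ioc (hi.mono_set (Ioc_subset_Ioc_right hab))
    (hi.mono_set (Ioc_subset_Ioc_left zero_le))]

lemma abs_setIntegral_sub_sum_le (hx : IsCadlag x) (hm : Monotone ζ) (hζ : IsCadlag ζ) {m : ℕ}
    {u : ℕ → ℝ≥0} (hu : Monotone u) (hu0 : u 0 = 0) {ε K ω : ℝ}
    (hosc : ∀ i < m, ∀ s, u i ≤ s → s < u (i + 1) → |x s - x (u i)| ≤ ε)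
    (hK : ∀ s ≤ u m, |x s| ≤ K) (hg : Continuous g)
    (hω : ∀ y ∈ Icc (-K) K, ∀ z ∈ Icc (-K) K, |y - z| ≤ ε → |g y - g z| ≤ ω) :
    |∫ s in Ioc 0 (u m), g (Function.leftLim x s) ∂(stieltjesMeasure ζ hm hζ) -
      ∑ i ∈ Finset.range m, g (x (u i)) * (ζ (u (i + 1)) - ζ (u i))| ≤ ω * (ζ (u m) - ζ 0) := by
  have main : ∀ n ≤ m, |∫ s in Ioc 0 (u n), g (Function.leftLim x s) ∂(stieltjesMeasure ζ hm hζ) -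
      ∑ i ∈ Finset.range n, g (x (u i)) * (ζ (u (i + 1)) - ζ (u i))| ≤ ω * (ζ (u n) - ζ 0) := by
    intro n
    induction n with
    | zero => intro _; simp [hu0]
    | succ n ih =>
      intro hn
      have h := ih (by omega)
      have hle := hu (Nat.le_succ n)
      have hfin : stieltjesMeasure ζ hm hζ (Ioc (u n) (u (n + 1))) < ⊤ := by
        rw [stieltjesMeasure_Ioc]; exact ENNReal.ofReal_lt_top
      have hb := norm_setIntegral_le_of_norm_le_const (μ := stieltjesMeasure ζ hm hζ)
        (f := fun s => g (Function.leftLim x s) - g (x (u n))) (C := ω) hfin fun s hs =>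
          hω _ (abs_le.1 (abs_leftLim_le hx (fun r hr => hK r (hr.trans (hu hn)))
            ⟨zero_le.trans_lt hs.1, hs.2⟩)) _ (abs_le.1 (hK _ (hle.trans (hu hn))))
            (abs_leftLim_sub_le hx (hosc n hn) hs)
      rw [integral_sub ((integrableOn_comp_leftLim hx hm hζ hg (u (n + 1))).mono_set
        (Ioc_subset_Ioc_left zero_le)) (integrableOn_const hfin.ne), setIntegral_const,
        stieltjesMeasure_real_Ioc hm hζ hle, smul_eq_mul, Real.norm_eq_abs] at hb
      rw [Finset.sum_range_succ, setIntegral_Ioc_succ hx hm hζ hg hle]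
      rw [abs_le] at h hb ⊢
      constructor <;> linarith [h.1, h.2, hb.1, hb.2]
  exact main m le_rfl

end Estimates

/-! ### Pointwise and locally uniform convergence -/

section Convergence

variable {x ζ : ℝ≥0 → ℝ} {φ : ℝ → ℝ} {g : ℝ → ℝ}

lemma nonneg_and_monotone_of_tendsto_downTruncVar (hx : IsCadlag x)
    (hφ_nonneg : ∀ c : ℝ, 0 < c → 0 ≤ φ c)
    (hD : ∀ t : ℝ≥0, Tendsto (fun c => 2 * φ c * (downTruncVar c x 0 t).toReal) (𝓝[>] 0)
      (𝓝 (ζ t))) : (∀ t, 0 ≤ ζ t) ∧ Monotone ζ := by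
  constructor
  · refine fun t => ge_of_tendsto (hD t) ?_
    filter_upwards [self_mem_nhdsWithin] with c hc
    have := hφ_nonneg c hc
    positivity
  · refine fun s t hst => le_of_tendsto_of_tendsto (hD s) (hD t) ?_
    filter_upwards [self_mem_nhdsWithin] with c hc
    have := hφ_nonneg c hc
    gcongr
    · exact hx.downTruncVar_ne_top hc t
    · exact downTruncVar_mono_time c x hst

/-- The partition is fixed before `c` tends to `0`, so the block errors have a fixed total bound and
are killed by `φ c`, while the finite sum converges term by term. -/
lemma tendsto_integral_downCross_mul (hx : IsCadlag x) (hm : Monotone ζ) (hζ : IsCadlag ζ)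
    (hφ_nonneg : ∀ c : ℝ, 0 < c → 0 ≤ φ c) (hφ : Tendsto φ (𝓝[>] 0) (𝓝 0))
    (hD : ∀ t : ℝ≥0, Tendsto (fun c => 2 * φ c * (downTruncVar c x 0 t).toReal) (𝓝[>] 0)
      (𝓝 (ζ t))) (hg : Continuous g) (t : ℝ≥0) :
    Tendsto (fun c => φ c * ∫ y, 2 * (downCross y c x 0 t : ℝ) * g y) (𝓝[>] 0)
      (𝓝 (∫ s in Ioc 0 t, g (Function.leftLim x s) ∂(stieltjesMeasure ζ hm hζ))) := by
  have hζ0 := (nonneg_and_monotone_of_tendsto_downTruncVar hx hφ_nonneg hD).1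
  obtain ⟨K, hK0, hK⟩ := hx.exists_bound t
  obtain ⟨G, hG⟩ := isCompact_Icc.exists_bound_of_continuousOn (s := Icc (-K) K) hg.continuousOn
  rw [Metric.tendsto_nhds]
  intro η hη
  -- The crossing side contributes `ω * ζ t` in the limit and the Stieltjes side at most as much
  -- again; the `+ 1` covers `ζ t = 0`.
  set ω : ℝ := η / (2 * ζ t + 1) with hω_def
  have hζt := hζ0 t
  have hωpos : 0 < ω := by positivity
  have hω2 : 2 * ω * ζ t < η := by
    rw [hω_def, mul_comm 2, mul_assoc, div_mul_eq_mul_div, div_lt_iff₀ (by positivity)]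
    linarith
  have huc := isCompact_Icc.uniformContinuousOn_of_continuous (s := Icc (-K) K) hg.continuousOn
  rw [Metric.uniformContinuousOn_iff_le] at huc
  obtain ⟨ε, hε, hgε⟩ := huc ω hωpos
  simp only [Real.dist_eq] at hgε
  obtain ⟨m, u, ⟨hu, hu0, hum⟩, hosc⟩ := hx.exists_partition hε t
  subst hum
  have hS := abs_setIntegral_sub_sum_le hx hm hζ hu hu0 hosc hK hg hgε
  set I := ∫ s in Ioc 0 (u m), g (Function.leftLim x s) ∂(stieltjesMeasure ζ hm hζ)
  set S := ∑ i ∈ Finset.range m, g (x (u i)) * (ζ (u (i + 1)) - ζ (u i))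
  set D : ℝ → ℝ≥0 → ℝ := fun c t => (downTruncVar c x 0 t).toReal
  set Sc : ℝ → ℝ := fun c => ∑ i ∈ Finset.range m,
    g (x (u i)) * (2 * φ c * D c (u (i + 1)) - 2 * φ c * D c (u i))
  have hSc : Tendsto Sc (𝓝[>] 0) (𝓝 S) :=
    tendsto_finsetSum _ fun i _ => ((hD _).sub (hD _)).const_mul _
  have hlim : Tendsto (fun c => ω * (2 * φ c * D c (u m)) + 2 * φ c * (m * (4 * G * K)) +
      |Sc c - S| + ω * (ζ (u m) - ζ 0)) (𝓝[>] 0) (𝓝 (ω * ζ (u m) + 2 * 0 * (m * (4 * G * K)) +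
      |S - S| + ω * (ζ (u m) - ζ 0))) :=
    ((((hD _).const_mul ω).add ((hφ.const_mul 2).mul_const _)).add
      (hSc.sub_const S).abs).add tendsto_const_nhds
  have hlt : ω * ζ (u m) + 2 * 0 * (m * (4 * G * K)) + |S - S| + ω * (ζ (u m) - ζ 0) < η := by
    have := mul_nonneg hωpos.le (hζ0 0)
    simp only [sub_self, abs_zero]
    linarith
  filter_upwards [hlim.eventually_lt_const hlt, self_mem_nhdsWithin] with c hc hc0
  have h1 := hx.abs_integral_downCross_mul_sub_sum_le hc0 hu hu0 hosc hK hg hG hωpos.le hgε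
  have h2φ : 0 ≤ 2 * φ c := by linarith [hφ_nonneg c hc0]
  have h2 := mul_le_mul_of_nonneg_left h1 h2φ
  have e : Sc c = 2 * φ c * ∑ i ∈ Finset.range m, g (x (u i)) * (D c (u (i + 1)) - D c (u i)) := by
    rw [Finset.mul_sum]
    refine Finset.sum_congr rfl fun i _ => ?_
    ring
  rw [← abs_of_nonneg h2φ, ← abs_mul, mul_sub, abs_of_nonneg h2φ, ← e] at h2
  simp only [mul_assoc (2 : ℝ)] at h2 ⊢
  rw [integral_const_mul, Real.dist_eq]
  refine lt_of_le_of_lt ?_ hc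
  rw [mul_left_comm]
  set J := 2 * (φ c * ∫ y, (downCross y c x 0 (u m) : ℝ) * g y)
  rw [abs_le] at h2 hS ⊢
  have h3 := abs_le.1 (le_refl |Sc c - S|)
  constructor <;> linarith [h2.1, h2.2, hS.1, hS.2, h3.1, h3.2]

/-- Pólya's theorem: monotone functions that converge pointwise to a continuous limit converge
uniformly on compact sets. -/
lemma tendstoUniformlyOn_of_monotone {ι : Type*} {l : Filter ι} [l.NeBot] {F : ι → ℝ≥0 → ℝ}
    {f : ℝ≥0 → ℝ} (hF : ∀ᶠ i in l, Monotone (F i)) (hf : Continuous f)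
    (h : ∀ t, Tendsto (fun i => F i t) l (𝓝 (f t))) {K : Set ℝ≥0} (hK : IsCompact K) :
    TendstoUniformlyOn F f l K := by
  have hfm : Monotone f := fun s t hst => le_of_tendsto_of_tendsto (h s) (h t)
    (hF.mono fun i hi => hi hst)
  have hfc : IsCadlag f := ⟨fun t => hf.continuousWithinAt, fun t _ =>
    ⟨f t, hf.continuousAt.tendsto.mono_left nhdsWithin_le_nhds⟩⟩
  obtain ⟨T, hT⟩ := hK.bddAbove
  rw [Metric.tendstoUniformlyOn_iff]
  intro η hη
  obtain ⟨m, u, ⟨hu, hu0, hum⟩, hosc⟩ := hfc.exists_partition (ε := η / 3) (by positivity) T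
  -- Continuity extends the oscillation bound from `[u i, u (i + 1))` to its right endpoint.
  have hosc' : ∀ i < m, f (u (i + 1)) ≤ f (u i) + η / 3 := by
    intro i hi
    rcases (hu (Nat.le_succ i)).eq_or_lt with heq | hlt
    · simp only [Nat.succ_eq_add_one] at heq
      rw [← heq]; linarith
    · have h1 := abs_leftLim_sub_le hfc (hosc i hi) ⟨hlt, le_rfl⟩
      have : (𝓝[<] u (i + 1)).NeBot := nhdsLT_neBot_of_exists_lt ⟨_, hlt⟩
      rw [hf.continuousWithinAt.leftLim_eq] at h1
      linarith [(abs_le.1 h1).2]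
  have hfind : ∀ n s, s ≤ u n → s = 0 ∨ ∃ i < n, u i ≤ s ∧ s ≤ u (i + 1) := by
    intro n s
    induction n with
    | zero => intro hs; left; rwa [hu0, nonpos_iff_eq_zero] at hs
    | succ n ih =>
      intro hs
      rcases le_total s (u n) with h1 | h1
      · rcases ih h1 with h2 | ⟨i, hi, h2⟩
        · exact Or.inl h2
        · exact Or.inr ⟨i, by omega, h2⟩
      · exact Or.inr ⟨n, by omega, h1, hs⟩
  have hev : ∀ᶠ j in l, ∀ i ∈ Finset.range (m + 1), |F j (u i) - f (u i)| < η / 3 := by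
    rw [Filter.eventually_all_finset]
    intro i _
    have := (Metric.tendsto_nhds.1 (h (u i))) (η / 3) (by positivity)
    simpa only [Real.dist_eq] using this
  filter_upwards [hev, hF] with j hj hjm s hs
  rw [dist_comm, Real.dist_eq]
  rcases hfind m s ((hT hs).trans hum.ge) with h1 | ⟨i, hi, h1, h2⟩
  · have := hj 0 (by simp)
    rw [hu0, ← h1] at this
    linarith
  · have a1 := abs_lt.1 (hj i (by simp; omega))
    have a2 := abs_lt.1 (hj (i + 1) (by simp; omega))
    have a3 := hosc' i hi
    have a4 := hjm h1
    have a5 := hjm h2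
    have a6 := hfm h1
    have a7 := hfm h2
    rw [abs_lt]
    constructor <;> linarith [a1.1, a1.2, a2.1, a2.2]

lemma continuous_setIntegral_comp_leftLim (hx : IsCadlag x) (hm : Monotone ζ) (hζ : IsCadlag ζ)
    (hg : Continuous g) (hc : Continuous ζ) :
    Continuous fun t => ∫ s in Ioc 0 t, g (Function.leftLim x s) ∂(stieltjesMeasure ζ hm hζ) := by
  rw [continuous_iff_continuousAt]
  intro t
  obtain ⟨K, -, hK⟩ := hx.exists_bound (t + 1)
  obtain ⟨G, hG⟩ := isCompact_Icc.exists_bound_of_continuousOn (s := Icc (-K) K) hg.continuousOn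
  have key : ∀ a b, a ≤ b → b ≤ t + 1 →
      |∫ s in Ioc 0 b, g (Function.leftLim x s) ∂(stieltjesMeasure ζ hm hζ) -
        ∫ s in Ioc 0 a, g (Function.leftLim x s) ∂(stieltjesMeasure ζ hm hζ)| ≤
        G * |ζ b - ζ a| := by
    intro a b hab hb
    rw [setIntegral_Ioc_succ hx hm hζ hg hab, add_sub_cancel_left,
      abs_of_nonneg (sub_nonneg.2 (hm hab)), ← stieltjesMeasure_real_Ioc hm hζ hab]
    exact norm_setIntegral_le_of_norm_le_const
      (by rw [stieltjesMeasure_Ioc]; exact ENNReal.ofReal_lt_top) fun s hs =>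
        hG _ (abs_le.1 (abs_leftLim_le hx hK ⟨zero_le.trans_lt hs.1, hs.2.trans hb⟩))
  have h0 : Tendsto (fun s => G * |ζ s - ζ t|) (𝓝 t) (𝓝 0) := by
    have := ((hc.tendsto t).sub_const (ζ t)).abs.const_mul G
    simpa using this
  refine tendsto_iff_dist_tendsto_zero.2 (squeeze_zero' (Eventually.of_forall fun _ => dist_nonneg)
    ?_ h0)
  filter_upwards [Iic_mem_nhds (show t < t + 1 from lt_add_one t)] with s hs
  rw [Real.dist_eq]
  rcases le_total s t with h | h
  · rw [abs_sub_comm, abs_sub_comm (ζ s)]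
    exact key s t h (by simp)
  · exact key t s h hs

/-- Crossing counts increase with time, so for a non-negative weight the integrals are monotone in
`t` and Pólya's theorem applies. A general `g` is the difference of its positive and negative parts.
-/
lemma tendstoUniformlyOn_integral_downCross_mul (hx : IsCadlag x) (hm : Monotone ζ)
    (hζ : IsCadlag ζ) (hφ_nonneg : ∀ c : ℝ, 0 < c → 0 ≤ φ c) (hφ : Tendsto φ (𝓝[>] 0) (𝓝 0))
    (hD : ∀ t : ℝ≥0, Tendsto (fun c => 2 * φ c * (downTruncVar c x 0 t).toReal) (𝓝[>] 0)
      (𝓝 (ζ t))) (hg : Continuous g) (hc : Continuous ζ) {K : Set ℝ≥0} (hK : IsCompact K) :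
    TendstoUniformlyOn (fun c t => φ c * ∫ y, 2 * (downCross y c x 0 t : ℝ) * g y)
      (fun t => ∫ s in Ioc 0 t, g (Function.leftLim x s) ∂(stieltjesMeasure ζ hm hζ))
      (𝓝[>] 0) K := by
  have nonneg_case : ∀ h : ℝ → ℝ, Continuous h → (∀ y, 0 ≤ h y) →
      TendstoUniformlyOn (fun c t => φ c * ∫ y, 2 * (downCross y c x 0 t : ℝ) * h y)
        (fun t => ∫ s in Ioc 0 t, h (Function.leftLim x s) ∂(stieltjesMeasure ζ hm hζ))
        (𝓝[>] 0) K := by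
    intro h hh h0
    refine tendstoUniformlyOn_of_monotone ?_ (continuous_setIntegral_comp_leftLim hx hm hζ hh hc)
      (tendsto_integral_downCross_mul hx hm hζ hφ_nonneg hφ hD hh) hK
    filter_upwards [self_mem_nhdsWithin] with c hc0 s t hst
    refine mul_le_mul_of_nonneg_left ?_ (hφ_nonneg c hc0)
    simp only [mul_assoc]
    refine integral_mono ((hx.integrable_downCross_mul hc0 hh s).const_mul 2)
      ((hx.integrable_downCross_mul hc0 hh t).const_mul 2) fun y => ?_
    have h1 : (downCross y c x 0 s : ℝ) ≤ downCross y c x 0 t :=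
      Nat.cast_le.2 (hx.downCross_mono hc0 hst y)
    have h2 := mul_le_mul_of_nonneg_right h1 (h0 y)
    simp only
    linarith
  have hp : Continuous fun y => max (g y) 0 := hg.max continuous_const
  have hn : Continuous fun y => max (-g y) 0 := hg.neg.max continuous_const
  have hpn : ∀ y, g y = max (g y) 0 - max (-g y) 0 := fun y => by
    rcases le_total (g y) 0 with h | h
    · rw [max_eq_right h, max_eq_left (by linarith)]; ring
    · rw [max_eq_left h, max_eq_right (by linarith)]; ring
  have := (nonneg_case _ hp fun y => le_max_right _ _).sub
    (nonneg_case _ hn fun y => le_max_right _ _)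
  refine TendstoUniformlyOn.congr_right (this.congr ?_) fun t _ => ?_
  · filter_upwards [self_mem_nhdsWithin] with c hc0 t _
    simp only [Pi.sub_apply, mul_assoc]
    rw [← mul_sub, ← integral_sub ((hx.integrable_downCross_mul hc0 hp t).const_mul 2)
      ((hx.integrable_downCross_mul hc0 hn t).const_mul 2)]
    congr 1
    refine integral_congr_ae (Eventually.of_forall fun y => ?_)
    simp only
    rw [← mul_sub, ← mul_sub, ← hpn y]
  · simp only [Pi.sub_apply]
    rw [← integral_sub (integrableOn_comp_leftLim hx hm hζ hp t)
      (integrableOn_comp_leftLim hx hm hζ hn t)]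
    exact integral_congr_ae (Eventually.of_forall fun s => (hpn _).symm)

end Convergence

/-! ### Upcrossings by reflection -/

section UpCross

variable {x ζ : ℝ≥0 → ℝ} {φ : ℝ → ℝ} {g : ℝ → ℝ}

lemma leftLim_neg (hx : IsCadlag x) (s : ℝ≥0) :
    Function.leftLim (fun u => -x u) s = -Function.leftLim x s := by
  rcases eq_or_lt_of_le (zero_le (a := s)) with h | h
  · subst h
    rw [leftLim_eq_of_isBot (a := (0 : ℝ≥0)) fun _ => zero_le,
      leftLim_eq_of_isBot (a := (0 : ℝ≥0)) fun _ => zero_le]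
  · have : (𝓝[<] s).NeBot := nhdsLT_neBot_of_exists_lt ⟨0, h⟩
    exact leftLim_eq_of_tendsto (hx.tendsto_leftLim h).neg

lemma integral_upCross_mul (x : ℝ≥0 → ℝ) (c : ℝ) (g : ℝ → ℝ) (t : ℝ≥0) :
    ∫ y, 2 * (upCross y c x 0 t : ℝ) * g y =
      ∫ y, 2 * (downCross y c (fun u => -x u) 0 t : ℝ) * g (-y) := by
  rw [← integral_neg_eq_self]
  simp only [upCross, neg_neg]

lemma IsCadlag.integrable_upCross_mul (hx : IsCadlag x) {c : ℝ} (hc : 0 < c) (hg : Continuous g)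
    (t : ℝ≥0) : Integrable fun y => (upCross y c x 0 t : ℝ) * g y := by
  have := (hx.neg.integrable_downCross_mul hc (hg.comp continuous_neg) t).comp_neg
  simpa only [upCross, Function.comp_apply, neg_neg] using this

lemma setIntegral_leftLim_neg (hx : IsCadlag x) (μ : Measure ℝ≥0) (g : ℝ → ℝ) (t : ℝ≥0) :
    ∫ s in Ioc 0 t, g (-Function.leftLim (fun u => -x u) s) ∂μ =
      ∫ s in Ioc 0 t, g (Function.leftLim x s) ∂μ := by
  simp only [leftLim_neg hx, neg_neg]

end UpCross

/-! ### Assembly of the theorem -/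

theorem theorem1 (x ζ : ℝ≥0 → ℝ) (φ : ℝ → ℝ) (hx : IsCadlag x) (hζ : IsCadlag ζ)
    (hφ_nonneg : ∀ c : ℝ, 0 < c → 0 ≤ φ c) (hφ : Tendsto φ (𝓝[>] 0) (𝓝 0)) :
    -- the three assumptions on the truncated variations are equivalent
    List.TFAE
      [∀ t : ℝ≥0, Tendsto (fun c => φ c * (truncVar c x 0 t).toReal) (𝓝[>] 0) (𝓝 (ζ t)),
       ∀ t : ℝ≥0, Tendsto (fun c => 2 * φ c * (upTruncVar c x 0 t).toReal) (𝓝[>] 0) (𝓝 (ζ t)),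
       ∀ t : ℝ≥0, Tendsto (fun c => 2 * φ c * (downTruncVar c x 0 t).toReal) (𝓝[>] 0) (𝓝 (ζ t))] ∧
    -- and under any of them the conclusions hold
    (((∀ t : ℝ≥0, Tendsto (fun c => φ c * (truncVar c x 0 t).toReal) (𝓝[>] 0) (𝓝 (ζ t))) ∨
      (∀ t : ℝ≥0, Tendsto (fun c => 2 * φ c * (upTruncVar c x 0 t).toReal) (𝓝[>] 0) (𝓝 (ζ t))) ∨
      (∀ t : ℝ≥0,
        Tendsto (fun c => 2 * φ c * (downTruncVar c x 0 t).toReal) (𝓝[>] 0) (𝓝 (ζ t)))) →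
      (∀ t : ℝ≥0, 0 ≤ ζ t) ∧
      ∃ hm : Monotone ζ, ∀ g : ℝ → ℝ, Continuous g →
        (∀ t : ℝ≥0, IntegrableOn (fun s => g (Function.leftLim x s)) (Ioc 0 t)
          (stieltjesMeasure ζ hm hζ)) ∧
        ∀ N : ℝ → ℝ → ℝ≥0 → ℝ,
          (N = (fun y c t => (crossNum y c x 0 t : ℝ)) ∨
           N = (fun y c t => 2 * (upCross y c x 0 t : ℝ)) ∨
           N = (fun y c t => 2 * (downCross y c x 0 t : ℝ))) →
          (∀ c : ℝ, 0 < c → ∀ t : ℝ≥0, Integrable (fun y => N y c t * g y)) ∧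
          (∀ t : ℝ≥0, Tendsto (fun c => φ c * ∫ y, N y c t * g y) (𝓝[>] 0)
            (𝓝 (∫ s in Ioc 0 t, g (Function.leftLim x s) ∂(stieltjesMeasure ζ hm hζ)))) ∧
          (Continuous ζ → ∀ K : Set ℝ≥0, IsCompact K →
            TendstoUniformlyOn (fun c t => φ c * ∫ y, N y c t * g y)
              (fun t => ∫ s in Ioc 0 t, g (Function.leftLim x s) ∂(stieltjesMeasure ζ hm hζ))
              (𝓝[>] 0) K)) := by
  have h_up : (∀ t : ℝ≥0, Tendsto (fun c => φ c * (truncVar c x 0 t).toReal) (𝓝[>] 0)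
      (𝓝 (ζ t))) ↔ (∀ t : ℝ≥0, Tendsto (fun c => 2 * φ c * (upTruncVar c x 0 t).toReal) (𝓝[>] 0)
      (𝓝 (ζ t))) := forall_congr' fun t => hx.tendsto_truncVar_iff_up hφ
  have h_down : (∀ t : ℝ≥0, Tendsto (fun c => φ c * (truncVar c x 0 t).toReal) (𝓝[>] 0)
      (𝓝 (ζ t))) ↔ (∀ t : ℝ≥0, Tendsto (fun c => 2 * φ c * (downTruncVar c x 0 t).toReal) (𝓝[>] 0)
      (𝓝 (ζ t))) := forall_congr' fun t => hx.tendsto_truncVar_iff hφ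
  refine ⟨?_, fun h => ?_⟩
  · tfae_have 1 ↔ 2 := h_up
    tfae_have 1 ↔ 3 := h_down
    tfae_finish
  have hT : ∀ t : ℝ≥0, Tendsto (fun c => φ c * (truncVar c x 0 t).toReal) (𝓝[>] 0)
      (𝓝 (ζ t)) := by
    rcases h with h | h | h
    exacts [h, h_up.2 h, h_down.2 h]
  have hD := h_down.1 hT
  have hU := h_up.1 hT
  -- In this form `hU` is the downward hypothesis for `-x`, with the same `ζ`.
  simp only [upTruncVar_eq_downTruncVar_neg] at hU
  obtain ⟨h0, hm⟩ := nonneg_and_monotone_of_tendsto_downTruncVar hx hφ_nonneg hD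
  refine ⟨h0, hm, fun g hg => ⟨integrableOn_comp_leftLim hx hm hζ hg, ?_⟩⟩
  have hg' : Continuous fun y => g (-y) := hg.comp continuous_neg
  have down_int : ∀ c : ℝ, 0 < c → ∀ t : ℝ≥0,
      Integrable fun y => 2 * (downCross y c x 0 t : ℝ) * g y := fun c hc t => by
    simpa only [mul_assoc] using (hx.integrable_downCross_mul hc hg t).const_mul 2
  have up_int : ∀ c : ℝ, 0 < c → ∀ t : ℝ≥0,
      Integrable fun y => 2 * (upCross y c x 0 t : ℝ) * g y := fun c hc t => by
    simpa only [mul_assoc] using (hx.integrable_upCross_mul hc hg t).const_mul 2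
  have down_lim := tendsto_integral_downCross_mul hx hm hζ hφ_nonneg hφ hD hg
  have up_lim := tendsto_integral_downCross_mul hx.neg hm hζ hφ_nonneg hφ hU hg'
  have down_unif := fun hc K hK => tendstoUniformlyOn_integral_downCross_mul (K := K) hx hm hζ
    hφ_nonneg hφ hD hg hc hK
  have up_unif := fun hc K hK => tendstoUniformlyOn_integral_downCross_mul (K := K) hx.neg hm hζ
    hφ_nonneg hφ hU hg' hc hK
  simp only [setIntegral_leftLim_neg hx, ← integral_upCross_mul] at up_lim up_unif
  -- The crossing number is the average of `2u` and `2d`, which have the same limit, so its limit is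
  -- theirs.
  have cross_eq : ∀ c y t, (crossNum y c x 0 t : ℝ) * g y =
      1 / 2 * (2 * (upCross y c x 0 t : ℝ) * g y + 2 * (downCross y c x 0 t : ℝ) * g y) :=
    fun c y t => by
      simp only [crossNum, Nat.cast_add]
      ring
  have cross_integral : ∀ c : ℝ, 0 < c → ∀ t : ℝ≥0,
      φ c * ∫ y, (crossNum y c x 0 t : ℝ) * g y =
        1 / 2 * (φ c * ∫ y, 2 * (upCross y c x 0 t : ℝ) * g y) +
        1 / 2 * (φ c * ∫ y, 2 * (downCross y c x 0 t : ℝ) * g y) := fun c hc t => by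
    simp only [cross_eq]
    rw [integral_const_mul, integral_add (up_int c hc t) (down_int c hc t)]
    ring
  rintro N (rfl | rfl | rfl)
  · refine ⟨fun c hc t => ?_, fun t => ?_, fun hc K hK => ?_⟩
    · simp only [cross_eq]
      exact ((up_int c hc t).add (down_int c hc t)).const_mul _
    · have := ((up_lim t).const_mul (1 / 2)).add ((down_lim t).const_mul (1 / 2))
      rw [← add_mul, show (1 / 2 + 1 / 2 : ℝ) = 1 by norm_num, one_mul] at this
      refine this.congr' ?_
      filter_upwards [self_mem_nhdsWithin] with c hc
      exact (cross_integral c hc t).symm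
    · have hu := up_unif hc K hK
      have hd := down_unif hc K hK
      rw [Metric.tendstoUniformlyOn_iff] at hu hd ⊢
      intro ε hε
      filter_upwards [hu ε hε, hd ε hε, self_mem_nhdsWithin] with c h1 h2 hc0 t ht
      have e1 := abs_lt.1 (h1 t ht)
      have e2 := abs_lt.1 (h2 t ht)
      rw [Real.dist_eq, cross_integral c hc0 t, abs_lt]
      constructor <;> linarith [e1.1, e1.2, e2.1, e2.2]
  · exact ⟨up_int, up_lim, fun hc K hK => up_unif hc K hK⟩
  · exact ⟨down_int, down_lim, fun hc K hK => down_unif hc K hK⟩
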